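/- Let $K$ be a field of characteristic $0$. Symmetric functions over $K$ are the formal power series of bounded degree in countably many variables $x_1,x_2,\dots$ with coefficients in $K$ that are invariant under all permutations of the variables. For an integer partition $\nu$ let $m_\nu$ be the monomial symmetric function, let $\ell(\nu)$ be the number of parts of $\nu$, and put $\tilde m_\nu=r_1!\,r_2!\cdots m_\nu$, where $r_i$ is the number of parts of $\nu$ equal to $i$. For an integer partition $\lambda$ let $D_\lambda$ be the disjoint union of directed paths whose numbers of vertices are the parts of $\lambda$, and put $$\xi_\lambda=\sum_{F\subseteq E(D_\lambda)}\frac{\tilde m_{\pi(F)}}{\ell(\pi(F))!},$$ where $\pi(F)$ is the partition formed by the numbers of vertices of the connected components of the spanning subgraph of $D_\lambda$ with edge set $F$. For $d\ge 0$ and $S\subseteq[d-1]=\{1,\dots,d-1\}$ let $$Q_{S,d}=\sum_{\substack{i_1\le\cdots\le i_d\\ i_j<i_{j+1}\text{ if }j\in S}}x_{i_1}\cdots x_{i_d}$$ be Gessel's fundamental quasi-symmetric function, and let the type of $S$ be the partition of $d$ whose parts are the lengths of the subwords obtained by breaking the word $12\cdots d$ after each element of $S$. (a) Let $g$ be a symmetric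 function over $K$ and let $a_\lambda$, $b_{S,d}\in K$ be constants, all but finitely many of them zero, such that $g=\sum_\lambda a_\lambda\xi_\lambda$ and $g=\sum_{S,d}b_{S,d}Q_{S,d}$. Then for every $d\ge 0$ and every partition $\lambda$ of $d$ $$a_\lambda=\sum_{\substack{S\subseteq[d-1]\\ \operatorname{type}(S)=\lambda}}b_{S,d}.$$ (b) Suppose moreover that $K$ is an ordered field. Then every symmetric function that is $Q$-positive (a finite linear combination of functions $Q_{S,d}$ with nonnegative coefficients) is $\xi$-positive (a finite linear combination of functions $\xi_\lambda$ with nonnegative coefficients). (c) In particular, for $K$ ordered and every finite simple graph $G$, Stanley's chromatic symmetric function $X_G=\sum_\pi\tilde m_{\operatorname{type}(\pi)}$, where $\pi$ runs through the partitions of the vertex set of $G$ into stable sets and $\operatorname{type}(\pi)$ is the partition formed by the sizes of the blocks of $\pi$, is $\xi$-positive. -/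

import Mathlib

noncomputable section

/-- A symmetric function over `K`: a formal power series of bounded degree in the countably many
variables `x₀, x₁, x₂, …` that is invariant under all permutations of the variables. -/
def IsSymmetricFunction {K : Type*} [CommSemiring K] (g : MvPowerSeries ℕ K) : Prop :=
  (∀ (σ : Equiv.Perm ℕ) (e : ℕ →₀ ℕ),
      MvPowerSeries.coeff (e.mapDomain σ) g = MvPowerSeries.coeff e g) ∧
    ∃ N : ℕ, ∀ e : ℕ →₀ ℕ, MvPowerSeries.coeff e g ≠ 0 → e.degree ≤ N

/-- The monomial symmetric function `m_s`, where the integer partition `s` is given as its multiset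
of parts: the sum of all monomials whose nonzero exponents form the multiset `s`. -/
def monomialSymm (K : Type*) [CommSemiring K] (s : Multiset ℕ) : MvPowerSeries ℕ K :=
  fun e => if e.support.val.map e = s then 1 else 0

/-- `r_s! = r₁! r₂! ⋯`, where `rᵢ` is the number of parts of `s` that are equal to `i`. -/
def multFactorial (s : Multiset ℕ) : ℕ :=
  ∏ i ∈ s.toFinset, (s.count i).factorial

/-- The augmented monomial symmetric function `r_s! m_s`. -/
def augMonomialSymm (K : Type*) [CommSemiring K] (s : Multiset ℕ) : MvPowerSeries ℕ K :=
  (multFactorial s : K) • monomialSymm K s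

/-- The vertices of the disjoint union of directed paths with `l[0], l[1], …` vertices. -/
abbrev PathVertex (l : List ℕ) : Type := Σ i : Fin l.length, Fin (l.get i)

/-- The disjoint union of directed paths whose `i`-th path has `l[i]` vertices. -/
def pathDigraph (l : List ℕ) : Digraph (PathVertex l) where
  Adj u v := u.1 = v.1 ∧ (u.2 : ℕ) + 1 = v.2

open Classical in
/-- The set of edges of the disjoint union of directed paths. -/
def pathEdges (l : List ℕ) : Finset (PathVertex l × PathVertex l) :=
  Finset.univ.filter fun e => (pathDigraph l).Adj e.1 e.2

open Classical in
/-- `π(F)`: the multiset of the numbers of vertices of the connected components of the spanning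
subgraph with edge set `F`. -/
def componentSizes {V : Type*} [Fintype V] (F : Finset (V × V)) : Multiset ℕ :=
  (Finset.univ : Finset (SimpleGraph.fromRel fun u v => (u, v) ∈ F).ConnectedComponent).val.map
    fun c => c.supp.ncard

/-- The symmetric function `ξ_λ = ∑_F m̃_{π(F)} / ℓ(π(F))!`, where `F` runs through all sets of edges
of the disjoint union of directed paths whose numbers of vertices are the parts of `λ`. -/
def xi (K : Type*) [Field K] (p : Σ d : ℕ, Nat.Partition d) : MvPowerSeries ℕ K :=
  ∑ F ∈ (pathEdges (p.2.parts.sort (· ≥ ·))).powerset,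
    (((componentSizes F).card.factorial : ℕ) : K)⁻¹ • augMonomialSymm K (componentSizes F)

/-- The index set of the fundamental quasi-symmetric functions: the pairs of a natural number `d`
and a subset `S` of `[d - 1] = {1, …, d - 1}`. -/
abbrev FundIndex : Type := Σ d : ℕ, ↥(Finset.Icc 1 (d - 1)).powerset

/-- Gessel's fundamental quasi-symmetric function `Q_{S,d}`: the sum of the monomials
`x_{i₁} ⋯ x_{i_d}` over all sequences `i₁ ≤ ⋯ ≤ i_d` with `i_j < i_{j+1}` for all `j ∈ S`.
The entry with (one-based) number `j = k + 1` is `i k`. -/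
def fundQ (K : Type*) [CommSemiring K] (q : FundIndex) : MvPowerSeries ℕ K :=
  fun e => (Set.ncard {i : Fin q.1 → ℕ | Monotone i ∧
    (∀ k l : Fin q.1, (k : ℕ) + 1 = l → (k : ℕ) + 1 ∈ q.2.1 → i k < i l) ∧
    ∑ k, Finsupp.single (i k) 1 = e} : K)

/-- The type of a subset `S` of `[d - 1]`: the partition of `d` whose parts are the lengths of the
subwords obtained by breaking the word `1 2 ⋯ d` after each element of `S`. -/
def subsetType (d : ℕ) (S : Finset ℕ) : Nat.Partition d where
  parts := (((List.range' 1 d).splitBy fun i _ => decide (i ∉ S)).map List.length : List ℕ)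
  parts_pos := by
    intro n hn
    simp only [Multiset.mem_coe, List.mem_map] at hn
    obtain ⟨w, hw, rfl⟩ := hn
    exact List.length_pos_of_ne_nil (List.ne_nil_of_mem_splitBy hw)
  parts_sum := by
    rw [Multiset.sum_coe, ← List.length_flatten, List.flatten_splitBy, List.length_range']

/-- `g` is `Q`-positive: it is a linear combination of functions `Q_{S,d}` with nonnegative
coefficients. -/
def IsQPositive {K : Type*} [Field K] [LinearOrder K] (g : MvPowerSeries ℕ K) : Prop :=
  ∃ b : FundIndex →₀ K, Finsupp.linearCombination K (fundQ K) b = g ∧ ∀ q, 0 ≤ b q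

/-- `g` is `ξ`-positive: it is a linear combination of functions `ξ_λ` with nonnegative
coefficients. -/
def IsXiPositive {K : Type*} [Field K] [LinearOrder K] (g : MvPowerSeries ℕ K) : Prop :=
  ∃ a : (Σ d : ℕ, Nat.Partition d) →₀ K,
    Finsupp.linearCombination K (xi K) a = g ∧ ∀ p, 0 ≤ a p

open Classical in
/-- Stanley's chromatic symmetric function `X_G`: the sum of the augmented monomial symmetric
functions `m̃_{type π}` over all partitions `π` of the vertex set into stable sets. -/
def chromaticSymm (K : Type*) [CommSemiring K] {V : Type*} [Fintype V] (G : SimpleGraph V) :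
    MvPowerSeries ℕ K :=
  ∑ π : Finpartition (Finset.univ : Finset V) with ∀ B : Finset V, B ∈ π.parts → G.IsIndepSet (B : Set V),
    augMonomialSymm K (π.parts.val.map Finset.card)

end

/-! ### Counting bijections between families of exponents. -/

noncomputable section

/-! The proof rests on one linear operator, `symmetrize`, which averages the coefficients of a power
series over all rearrangements of the exponents of a monomial on its support. In characteristic zero
it fixes symmetric functions, and it sends `Q_{S,d}` to `ξ_{type(S)}` (`symmetrize_fundQ_eq_xi`).
Applying it to a symmetric `g = ∑ b_{S,d} Q_{S,d}` gives `g = ∑ b_{S,d} ξ_{type(S)}`. This proves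
(b) at once, and (a) once the `ξ_λ` are known to be linearly independent.

For the key identity, `Q_{S,d}` is the sum over `T ⊇ S` of the monomial quasi-symmetric functions
(`fundQ_eq_sum`). Symmetrizing the one for `T` gives the augmented monomial function of the type of
`T`, divided by the factorial of its number of parts (`symmetrize_quasiMono`). Breaking a path on
`d` vertices after the elements of `S` leaves paths of type `type(S)`, and the sets `T ⊇ S`
correspond to the edge subsets `F` of what is left, with `π(F)` the type of `T`
(`sum_powerset_cutPathEdges`). The two sums agree term by term.

Linear independence (`linearIndependent_xi`) is triangularity: deleting edges refines `λ`, so apart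
from `F` = all edges only partitions with more parts occur in `ξ_λ`.

For (c), `X_G` is shown to be symmetric and `Q`-positive. Its coefficients count proper colorings
(`chromaticSymm_apply`). Each coloring determines an acyclic orientation, a labelling decreasing
along it, and a total order of the vertices by color and then label. The proper colorings with a
given order contribute one `Q_{S,d}`, where `S` is the descent set of the labels
(`chromaticSymm_eq_sum`). -/

theorem exists_equiv_comp_eq {α β : Type*} [Fintype α] [Fintype β] {f : α → ℕ} {g : β → ℕ}
    (h : Finset.univ.val.map g = Finset.univ.val.map f) :
    ∃ ψ : α ≃ β, ∀ a, g (ψ a) = f a := by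
  classical
  have hc : ∀ n, Fintype.card {a // f a = n} = Fintype.card {b // g b = n} := by
    intro n
    have := congrArg (Multiset.count n) h
    rw [Multiset.count_map, Multiset.count_map] at this
    rw [Fintype.card_subtype, Fintype.card_subtype, Finset.card_def, Finset.card_def,
      Finset.filter_val, Finset.filter_val]
    simpa [eq_comm] using this.symm
  let e := fun n => Fintype.equivOfCardEq (hc n)
  exact ⟨(Equiv.sigmaFiberEquiv f).symm.trans
    ((Equiv.sigmaCongrRight e).trans (Equiv.sigmaFiberEquiv g)), fun a => (e (f a) ⟨a, rfl⟩).2⟩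

/-- The number of bijections that carry `f` to `g`. -/
theorem card_equiv_comp_eq {α β : Type*} [Fintype α] [Fintype β] (f : α → ℕ) (g : β → ℕ) :
    Nat.card {ψ : α ≃ β // ∀ a, g (ψ a) = f a} =
      if Finset.univ.val.map g = Finset.univ.val.map f then
        multFactorial (Finset.univ.val.map f) else 0 := by
  classical
  split_ifs with h
  · obtain ⟨ψ₀, hψ₀⟩ := exists_equiv_comp_eq h
    -- Such bijections form a torsor under the stabilizer of `f`; the base point `ψ₀` identifies the
    -- two.
    have e : {ψ : α ≃ β // ∀ a, g (ψ a) = f a} ≃ {σ : Equiv.Perm α // f ∘ σ = f} :=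
      { toFun := fun ψ => ⟨ψ.1.trans ψ₀.symm, by
          funext a
          have := hψ₀ (ψ₀.symm (ψ.1 a))
          simp only [Equiv.apply_symm_apply] at this
          simp [← this, ψ.2]⟩
        invFun := fun σ => ⟨σ.1.trans ψ₀, fun a => by
          simpa [hψ₀] using congrFun σ.2 a⟩
        left_inv := fun ψ => by ext; simp
        right_inv := fun ψ => by ext; simp }
    rw [Nat.card_congr e, Nat.card_eq_fintype_card, DomMulAct.stabilizer_card', multFactorial]
    refine Finset.prod_congr ?_ fun i _ => ?_
    · ext; simp
    · rw [Multiset.count_map, Fintype.card_subtype, Finset.card_def, Finset.filter_val]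
      simp [eq_comm]
  · rw [Nat.card_eq_zero]
    left
    refine ⟨fun ψ => h ?_⟩
    have : f = g ∘ ψ.1 := funext fun a => (ψ.2 a).symm
    rw [this, ← Multiset.map_map]
    congr 1
    have := congrArg Finset.val (Finset.map_univ_equiv ψ.1)
    simp

theorem map_support_eq (e : ℕ →₀ ℕ) :
    e.support.val.map e = (Finset.univ : Finset e.support).val.map fun x : e.support => e x := by
  have : (Finset.univ : Finset e.support).val.map (fun x : e.support => e x) =
      ((Finset.univ : Finset e.support).val.map Subtype.val).map e := by
    rw [Multiset.map_map]; rfl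
  rw [this]
  congr 1
  exact (Multiset.attach_map_val e.support.val).symm

/-! ### The symmetrization operator. -/

section symmetrize

variable {K : Type*} [Field K]

/-- The symmetrization of a power series: the coefficient at a monomial is replaced by the average
of the coefficients over all rearrangements of its exponents. -/
def symmetrize (K : Type*) [Field K] : MvPowerSeries ℕ K →ₗ[K] MvPowerSeries ℕ K where
  toFun f := fun e => ((e.support.card.factorial : ℕ) : K)⁻¹ *
    ∑ σ : Equiv.Perm e.support, f (e.mapDomain (Equiv.Perm.ofSubtype σ))
  map_add' f g := by
    funext e
    change _ * (∑ σ : Equiv.Perm e.support, (f _ + g _)) = _ * _ + _ * _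
    rw [Finset.sum_add_distrib, mul_add]
  map_smul' c f := by
    funext e
    change _ * (∑ σ : Equiv.Perm e.support, (c * f _)) = c * (_ * _)
    rw [← Finset.mul_sum, mul_left_comm]

theorem symmetrize_apply (f : MvPowerSeries ℕ K) (e : ℕ →₀ ℕ) :
    symmetrize K f e = ((e.support.card.factorial : ℕ) : K)⁻¹ *
      ∑ σ : Equiv.Perm e.support, f (e.mapDomain (Equiv.Perm.ofSubtype σ)) := rfl

theorem symmetrize_of_isSymmetricFunction [CharZero K] {f : MvPowerSeries ℕ K}
    (hf : IsSymmetricFunction f) : symmetrize K f = f := by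
  funext e
  rw [symmetrize_apply]
  have : ∀ σ : Equiv.Perm e.support, f (e.mapDomain (Equiv.Perm.ofSubtype σ)) = f e :=
    fun σ => hf.1 _ e
  rw [Finset.sum_congr rfl fun σ _ => this σ, Finset.sum_const, Finset.card_univ,
    Fintype.card_perm, Fintype.card_coe, nsmul_eq_mul, inv_mul_cancel_left₀]
  exact_mod_cast Nat.factorial_ne_zero _

end symmetrize

/-! ### Subsets of `[d - 1]` as compositions of `d`. -/

section compositions

/-- The composition of `d` that is obtained by breaking the word `1 2 ⋯ d` after each element
of `S`. -/
def setComp (d : ℕ) (S : Finset ℕ) : Composition d where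
  blocks := ((List.range' 1 d).splitBy fun i _ => decide (i ∉ S)).map List.length
  blocks_pos := by
    intro n hn
    simp only [List.mem_map] at hn
    obtain ⟨w, hw, rfl⟩ := hn
    exact List.length_pos_of_ne_nil (List.ne_nil_of_mem_splitBy hw)
  blocks_sum := by
    rw [← List.length_flatten, List.flatten_splitBy, List.length_range']

theorem subsetType_parts (d : ℕ) (S : Finset ℕ) :
    (subsetType d S).parts = ((setComp d S).blocks : Multiset ℕ) := rfl

theorem Composition.index_mono {d : ℕ} (c : Composition d) : Monotone c.index := by
  intro k l hkl
  by_contra h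
  have h : c.index l < c.index k := not_le.1 h
  have h1 := c.lt_sizeUpTo_index_succ l
  have h2 := c.sizeUpTo_index_le k
  have h3 := c.monotone_sizeUpTo (Nat.succ_le_of_lt h : (c.index l : ℕ).succ ≤ c.index k)
  have h4 : (k : ℕ) ≤ l := hkl
  simp only [Fin.val_succ] at h1
  simp only [Nat.succ_eq_add_one] at h3
  omega

theorem Composition.index_surjective {d : ℕ} (c : Composition d) :
    Function.Surjective c.index := fun b =>
  ⟨c.embedding b ⟨0, c.one_le_blocksFun b⟩, c.index_embedding _ _⟩

/-- Consecutive positions lie in different blocks if and only if the word is broken between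
them. -/
theorem setComp_index_lt_iff (d : ℕ) (S : Finset ℕ) (k l : Fin d) (hkl : (k : ℕ) + 1 = l) :
    (setComp d S).index k < (setComp d S).index l ↔ (k : ℕ) + 1 ∈ S := by
  set c := setComp d S with hc
  set L := (List.range' 1 d).splitBy fun i _ => decide (i ∉ S) with hL
  have hlen : c.blocks = L.map List.length := rfl
  have hLl : c.length = L.length := by simp [Composition.length, hlen]
  -- Cutting by the block lengths recovers the blocks, so their entries can be read off from the
  -- partial sums `c.sizeUpTo`.
  have hsplit : (List.range' 1 d).splitWrtComposition c = L := by
    have h1 : L.flatten = List.range' 1 d := List.flatten_splitBy _ _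
    have : L.flatten.splitWrtComposition c = L := List.splitWrtComposition_flatten L
      (c.cast (by rw [h1, List.length_range'] : d = L.flatten.length)) hlen.symm
    rwa [h1] at this
  have hget : ∀ (i : ℕ) (hi : i < L.length) (j : ℕ) (hj : j < L[i].length),
      L[i][j] = c.sizeUpTo i + j + 1 := by
    intro i hi j hj
    have h2 : L[i] = ((List.range' 1 d).take (c.sizeUpTo (i + 1))).drop (c.sizeUpTo i) := by
      have h3 := List.getElem_splitWrtComposition' (List.range' 1 d) c (i := i)
        (by rw [hsplit]; exact hi)
      rw [← h3]
      simp only [hsplit]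
    simp only [h2, List.getElem_drop, List.getElem_take, List.getElem_range']
    omega
  have hlenget : ∀ (i : ℕ) (hi : i < L.length), L[i].length + c.sizeUpTo i = c.sizeUpTo (i + 1) := by
    intro i hi
    rw [c.sizeUpTo_succ (hLl ▸ hi)]
    simp only [hlen, List.getElem_map]
    omega
  have hk1 := c.sizeUpTo_index_le k
  have hk2 := c.lt_sizeUpTo_index_succ k
  have hl1 := c.sizeUpTo_index_le l
  have hl2 := c.lt_sizeUpTo_index_succ l
  simp only [Fin.val_succ] at hk2 hl2
  have hmono : c.index k ≤ c.index l := c.index_mono (by rw [Fin.le_def]; omega)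
  have hbk : (c.index k : ℕ) < L.length := hLl ▸ (c.index k).2
  have hbl : (c.index l : ℕ) < L.length := hLl ▸ (c.index l).2
  constructor
  · intro hlt
    have hlt' : (c.index k : ℕ) + 1 ≤ c.index l := hlt
    have hlt2 := c.monotone_sizeUpTo hlt'
    -- Position `k` is the last of its block, and its letter is `k + 1` because the word starts at
    -- `1`. `splitBy` breaks after a letter only if that letter is in `S`.
    have hs : (k : ℕ) + 1 = c.sizeUpTo ((c.index k : ℕ) + 1) := by omega
    have hb1 : (c.index k : ℕ) + 1 < L.length := by omega
    have := List.isChain_iff_getElem.1 (List.isChain_getLast_head_splitBy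
      (fun i _ => decide (i ∉ S)) (List.range' 1 d)) (c.index k) hb1
    obtain ⟨ha, hb, hr⟩ := this
    simp only [decide_eq_false_iff_not, not_not] at hr
    rw [List.getLast_eq_getElem] at hr
    have hll := hlenget _ hbk
    have hpos : 0 < L[(c.index k : ℕ)].length := List.length_pos_of_ne_nil ha
    change L[(c.index k : ℕ)][L[(c.index k : ℕ)].length - 1] ∈ S at hr
    rw [hget _ hbk] at hr
    convert hr using 1
    omega
  · intro hS
    by_contra hnot
    have heq : c.index k = c.index l := le_antisymm hmono (not_lt.1 hnot)
    rw [← heq] at hl1 hl2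
    have hch := List.isChain_iff_getElem.1 (List.isChain_of_mem_splitBy (List.getElem_mem hbk))
      ((k : ℕ) - c.sizeUpTo (c.index k)) (by have := hlenget _ hbk; omega)
    simp only [decide_eq_true_eq] at hch
    apply hch
    rw [hget _ hbk]
    convert hS using 1
    omega

/-- If a monotone map increases at every step at which another one does, then it increases
between any two positions between which the other one does. -/
theorem lt_of_lt_of_succ {d : ℕ} {α β : Type*} [LinearOrder α] [LinearOrder β]
    {f : Fin d → α} {g : Fin d → β} (hf : Monotone f) (hg : Monotone g)
    (h : ∀ k l : Fin d, (k : ℕ) + 1 = l → f k < f l → g k < g l) {k l : Fin d}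
    (hkl : f k < f l) : g k < g l := by
  have key : ∀ (n : ℕ) (k l : Fin d), (k : ℕ) + n = l → f k < f l → g k < g l := by
    intro n
    induction n with
    | zero =>
      intro k l hkl
      obtain rfl : k = l := Fin.ext hkl
      simp
    | succ n ih =>
      intro k l hkl hlt
      have hm : (k : ℕ) + n < d := by have := l.2; omega
      have hkm : k ≤ ⟨k + n, hm⟩ := by rw [Fin.le_def]; simp
      have hml : (⟨k + n, hm⟩ : Fin d) ≤ l := by rw [Fin.le_def]; simp only; omega
      rcases (hf hkm).lt_or_eq with h3 | h3
      · exact (ih k ⟨k + n, hm⟩ rfl h3).trans_le (hg hml)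
      · exact (hg hkm).trans_lt (h ⟨k + n, hm⟩ l (by simp only; omega) (h3 ▸ hlt))
  rcases le_total k l with hle | hle
  · exact key (l - k) k l (by have : (k : ℕ) ≤ l := hle; omega) hkl
  · exact absurd (hf hle) (not_le.2 hkl)

/-- Two monotone maps that increase at the same steps increase between the same positions. -/
theorem lt_iff_lt_of_succ {d : ℕ} {α β : Type*} [LinearOrder α] [LinearOrder β]
    {f : Fin d → α} {g : Fin d → β} (hf : Monotone f) (hg : Monotone g)
    (h : ∀ k l : Fin d, (k : ℕ) + 1 = l → (f k < f l ↔ g k < g l)) (k l : Fin d) :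
    f k < f l ↔ g k < g l :=
  ⟨lt_of_lt_of_succ hf hg fun k l hkl => (h k l hkl).1,
    lt_of_lt_of_succ hg hf fun k l hkl => (h k l hkl).2⟩

end compositions

/-! ### Symmetrizing monomial and fundamental quasi-symmetric functions. -/

section quasiMono

variable {K : Type*} [Field K]

/-- The monomial quasi-symmetric function: the sum of the monomials `x_{i₁} ⋯ x_{i_d}` over all
sequences `i₁ ≤ ⋯ ≤ i_d` with `i_j < i_{j+1}` exactly for `j ∈ T`. -/
def quasiMono (K : Type*) [CommSemiring K] (d : ℕ) (T : Finset ℕ) : MvPowerSeries ℕ K :=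
  fun e => (Set.ncard {i : Fin d → ℕ | Monotone i ∧
    (∀ k l : Fin d, (k : ℕ) + 1 = l → (i k < i l ↔ (k : ℕ) + 1 ∈ T)) ∧
    ∑ k, Finsupp.single (i k) 1 = e} : K)

theorem MvPowerSeries.sum_apply {ι : Type*} (s : Finset ι) (f : ι → MvPowerSeries ℕ K)
    (e : ℕ →₀ ℕ) : (∑ i ∈ s, f i) e = ∑ i ∈ s, f i e :=
  map_sum (MvPowerSeries.coeff e) f s

theorem sum_single_apply {α : Type*} [Fintype α] (i : α → ℕ) (x : ℕ) :
    (∑ k, Finsupp.single (i k) 1 : ℕ →₀ ℕ) x = Fintype.card {k // i k = x} := by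
  classical
  rw [Finsupp.finsetSum_apply, Fintype.card_subtype, Finset.card_filter]
  simp [Finsupp.single_apply]

theorem finite_setOf_sum_single {α : Type*} [Fintype α] (e : ℕ →₀ ℕ) :
    {i : α → ℕ | ∑ k, Finsupp.single (i k) 1 = e}.Finite := by
  refine Set.Finite.subset (Set.Finite.pi' fun _ : α => e.support.finite_toSet) ?_
  rintro i rfl k
  have : 0 < Fintype.card {l // i l = i k} := Fintype.card_pos_iff.2 ⟨⟨k, rfl⟩⟩
  simp only [Finset.mem_coe, Finsupp.mem_support_iff, sum_single_apply]
  omega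

/-- A sequence with strict ascents exactly at `T` is a strictly increasing function of the
index of the block. -/
theorem monotone_ascents_iff (d : ℕ) (T : Finset ℕ) (i : Fin d → ℕ) :
    (Monotone i ∧ ∀ k l : Fin d, (k : ℕ) + 1 = l → (i k < i l ↔ (k : ℕ) + 1 ∈ T)) ↔
      ∃ φ : Fin (setComp d T).length → ℕ, StrictMono φ ∧ i = φ ∘ (setComp d T).index := by
  set c := setComp d T
  constructor
  · rintro ⟨hm, ha⟩
    have key := lt_iff_lt_of_succ hm c.index_mono fun k l hkl =>
      (ha k l hkl).trans (setComp_index_lt_iff d T k l hkl).symm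
    -- The value on a block is read at a representative; by `key` the sequence is constant on
    -- blocks.
    obtain ⟨s, hs⟩ := c.index_surjective.hasRightInverse
    refine ⟨i ∘ s, fun a b hab => (key _ _).2 (by rwa [hs, hs]), funext fun k => ?_⟩
    have h1 := (key k (s (c.index k))).not.2 (by rw [hs]; exact lt_irrefl _)
    have h2 := (key (s (c.index k)) k).not.2 (by rw [hs]; exact lt_irrefl _)
    exact le_antisymm (not_lt.1 h2) (not_lt.1 h1)
  · rintro ⟨φ, hφ, rfl⟩
    refine ⟨hφ.monotone.comp c.index_mono, fun k l hkl => ?_⟩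
    rw [← setComp_index_lt_iff d T k l hkl]
    exact hφ.lt_iff_lt

theorem sum_single_comp_index {d : ℕ} (c : Composition d) (φ : Fin c.length → ℕ) :
    (∑ k, Finsupp.single ((φ ∘ c.index) k) 1 : ℕ →₀ ℕ) =
      ∑ b, Finsupp.single (φ b) (c.blocksFun b) := by
  rw [← c.blocksFinEquiv.sum_comp, Fintype.sum_sigma]
  refine Finset.sum_congr rfl fun b _ => ?_
  have : ∀ j, (φ ∘ c.index) (c.blocksFinEquiv ⟨b, j⟩) = φ b := fun j =>
    congrArg φ (c.index_embedding b j)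
  simp only [this, Finset.sum_const, Finset.card_univ, Fintype.card_fin, Finsupp.smul_single,
    smul_eq_mul, mul_one]

theorem sum_single_eq_iff {r : ℕ} {φ : Fin r → ℕ} (hφ : Function.Injective φ) (w : Fin r → ℕ)
    (hw : ∀ b, 0 < w b) (f : ℕ →₀ ℕ) :
    (∑ b, Finsupp.single (φ b) (w b)) = f ↔
      Set.range φ = f.support ∧ ∀ b, f (φ b) = w b := by
  have hval : ∀ b, (∑ b, Finsupp.single (φ b) (w b)) (φ b) = w b := by
    intro b
    rw [Finsupp.finsetSum_apply, Finset.sum_eq_single b]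
    · simp
    · intro a _ hab
      exact Finsupp.single_eq_of_ne (fun h => hab (hφ h).symm)
    · simp
  have hout : ∀ x, x ∉ Set.range φ → (∑ b, Finsupp.single (φ b) (w b)) x = 0 := by
    intro x hx
    rw [Finsupp.finsetSum_apply]
    exact Finset.sum_eq_zero fun b _ => Finsupp.single_eq_of_ne (fun h => hx ⟨b, h.symm⟩)
  constructor
  · rintro rfl
    refine ⟨?_, hval⟩
    ext x
    simp only [Finset.mem_coe, Finsupp.mem_support_iff]
    constructor
    · rintro ⟨b, rfl⟩
      rw [hval]
      exact (hw b).ne'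
    · intro h
      by_contra hx
      exact h (hout x hx)
  · rintro ⟨h1, h2⟩
    ext x
    by_cases hx : x ∈ Set.range φ
    · obtain ⟨b, rfl⟩ := hx
      rw [hval, h2]
    · rw [hout x hx]
      rw [h1, Finset.mem_coe, Finsupp.mem_support_iff, not_not] at hx
      exact hx.symm

theorem support_mapDomain_ofSubtype (e : ℕ →₀ ℕ) (σ : Equiv.Perm e.support) :
    (e.mapDomain (Equiv.Perm.ofSubtype σ)).support = e.support := by
  classical
  rw [Finsupp.mapDomain_support_of_injective (Equiv.injective _)]
  ext x
  simp only [Finset.mem_image]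
  constructor
  · rintro ⟨y, hy, rfl⟩
    exact (Equiv.Perm.ofSubtype_apply_mem_iff_mem σ y).2 hy
  · intro hx
    exact ⟨σ.symm ⟨x, hx⟩, (σ.symm ⟨x, hx⟩).2, by
      rw [Equiv.Perm.ofSubtype_apply_coe, Equiv.apply_symm_apply]⟩

theorem mapDomain_ofSubtype_apply (e : ℕ →₀ ℕ) (σ : Equiv.Perm e.support) (x : e.support) :
    e.mapDomain (Equiv.Perm.ofSubtype σ) x = e (σ.symm x) := by
  conv_lhs => rw [← σ.apply_symm_apply x, ← Equiv.Perm.ofSubtype_apply_coe]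
  exact Finsupp.mapDomain_apply (Equiv.injective _) _ _

open Classical in
-- The block values of such a sequence increase strictly and exhaust the support, so they are its
-- increasing enumeration. At most one sequence remains, and it exists exactly when the rearranged
-- exponents are the block sizes in order.
theorem ncard_ascents_mapDomain (d : ℕ) (T : Finset ℕ) (e : ℕ →₀ ℕ)
    (h : e.support.card = (setComp d T).length) (σ : Equiv.Perm e.support) :
    Set.ncard {i : Fin d → ℕ | Monotone i ∧
      (∀ k l : Fin d, (k : ℕ) + 1 = l → (i k < i l ↔ (k : ℕ) + 1 ∈ T)) ∧
      ∑ k, Finsupp.single (i k) 1 = e.mapDomain (Equiv.Perm.ofSubtype σ)} =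
    if ∀ b, e (σ.symm (e.support.orderIsoOfFin h b)) = (setComp d T).blocksFun b
      then 1 else 0 := by
  set c := setComp d T
  have hset : {i : Fin d → ℕ | Monotone i ∧
      (∀ k l : Fin d, (k : ℕ) + 1 = l → (i k < i l ↔ (k : ℕ) + 1 ∈ T)) ∧
      ∑ k, Finsupp.single (i k) 1 = e.mapDomain (Equiv.Perm.ofSubtype σ)} =
      {i | i = e.support.orderEmbOfFin h ∘ c.index ∧
        ∀ b, e (σ.symm (e.support.orderIsoOfFin h b)) = c.blocksFun b} := by
    ext i
    rw [Set.mem_ofPred_eq, ← and_assoc, monotone_ascents_iff, Set.mem_ofPred_eq]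
    have hval : ∀ b, e.mapDomain (Equiv.Perm.ofSubtype σ) (e.support.orderEmbOfFin h b) =
        e (σ.symm (e.support.orderIsoOfFin h b)) := fun b =>
      mapDomain_ofSubtype_apply e σ (e.support.orderIsoOfFin h b)
    constructor
    · rintro ⟨⟨φ, hφ, rfl⟩, hs⟩
      rw [sum_single_comp_index, sum_single_eq_iff hφ.injective _ c.one_le_blocksFun,
        support_mapDomain_ofSubtype] at hs
      have hφ' : φ = e.support.orderEmbOfFin h :=
        Finset.orderEmbOfFin_unique h (fun b => by
          rw [← Finset.mem_coe, ← hs.1]; exact ⟨b, rfl⟩) hφ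
      refine ⟨by rw [hφ'], fun b => ?_⟩
      rw [← hval, ← hs.2 b, hφ']
    · rintro ⟨rfl, hb⟩
      refine ⟨⟨_, (e.support.orderEmbOfFin h).strictMono, rfl⟩, ?_⟩
      rw [sum_single_comp_index, sum_single_eq_iff (e.support.orderEmbOfFin h).injective _
        c.one_le_blocksFun, support_mapDomain_ofSubtype]
      exact ⟨Finset.range_orderEmbOfFin _ h, fun b => by rw [hval, hb]⟩
  rw [hset]
  split_ifs with hb
  · exact Set.ncard_eq_one.2 ⟨_, Set.ext fun i => and_iff_left hb⟩
  · convert Set.ncard_empty (Fin d → ℕ)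
    exact Set.eq_empty_of_forall_notMem fun i hi => hb hi.2

/-- Through the increasing enumeration of the support, the permutations that contribute become the
bijections from blocks to support that match sizes with exponents; `card_equiv_comp_eq` counts them.
-/
theorem sum_ncard_ascents_mapDomain (d : ℕ) (T : Finset ℕ) (e : ℕ →₀ ℕ) :
    ∑ σ : Equiv.Perm e.support, Set.ncard {i : Fin d → ℕ | Monotone i ∧
      (∀ k l : Fin d, (k : ℕ) + 1 = l → (i k < i l ↔ (k : ℕ) + 1 ∈ T)) ∧
      ∑ k, Finsupp.single (i k) 1 = e.mapDomain (Equiv.Perm.ofSubtype σ)} =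
    if e.support.val.map e = ((setComp d T).blocks : Multiset ℕ) then
      multFactorial (setComp d T).blocks else 0 := by
  classical
  set c := setComp d T with hc
  have hbl : (Finset.univ : Finset (Fin c.length)).val.map c.blocksFun = (c.blocks : Multiset ℕ) := by
    rw [Fin.univ_val_map, c.ofFn_blocksFun]
  rw [← hbl, map_support_eq, ← card_equiv_comp_eq c.blocksFun fun x : e.support => e x]
  by_cases h : e.support.card = c.length
  · rw [Finset.sum_congr rfl fun σ _ => ncard_ascents_mapDomain d T e h σ, ← Finset.card_filter,
      Nat.card_eq_fintype_card, Fintype.card_subtype]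
    set o : Fin c.length ≃ e.support := (e.support.orderIsoOfFin h).toEquiv
    refine Finset.card_bij (fun σ _ => o.trans σ.symm) ?_ ?_ ?_
    · intro σ hσ
      exact Finset.mem_filter.2 ⟨Finset.mem_univ _, (Finset.mem_filter.1 hσ).2⟩
    · intro σ _ τ _ hστ
      have : o.symm.trans (o.trans σ.symm) = o.symm.trans (o.trans τ.symm) := by
        exact congrArg o.symm.trans hστ
      rw [← Equiv.trans_assoc, ← Equiv.trans_assoc, Equiv.symm_trans_self, Equiv.refl_trans,
        Equiv.refl_trans] at this
      rw [← σ.symm_symm, this, τ.symm_symm]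
    · intro ψ hψ
      refine ⟨ψ.symm.trans o, ?_, ?_⟩
      · simp only [Finset.mem_filter, Finset.mem_univ, true_and] at hψ ⊢
        intro b
        rw [← hψ b]
        have : (e.support.orderIsoOfFin h) b = o b := rfl
        rw [this]
        simp
      · ext; simp
  · rw [Finset.sum_eq_zero, eq_comm, Nat.card_eq_zero]
    · left
      refine ⟨fun ψ => h ?_⟩
      have := Fintype.card_congr ψ.1
      simpa using this.symm
    · intro σ _
      rw [Set.ncard_eq_zero (Set.Finite.subset (finite_setOf_sum_single _) fun i hi => hi.2.2)]
      ext i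
      simp only [Set.mem_ofPred_eq, Set.mem_empty_iff_false, iff_false]
      rw [← and_assoc, monotone_ascents_iff]
      rintro ⟨⟨φ, hφ, rfl⟩, hs⟩
      rw [sum_single_comp_index, sum_single_eq_iff hφ.injective _ c.one_le_blocksFun,
        support_mapDomain_ofSubtype] at hs
      apply h
      have := congrArg Set.ncard hs.1
      rw [Set.ncard_coe_finset, ← Set.image_univ, Set.ncard_image_of_injective _ hφ.injective,
        Set.ncard_univ, Nat.card_eq_fintype_card, Fintype.card_fin] at this
      exact this.symm

/-- The symmetrization of a monomial quasi-symmetric function. -/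
theorem symmetrize_quasiMono (d : ℕ) (T : Finset ℕ) :
    symmetrize K (quasiMono K d T) =
      (((setComp d T).length.factorial : ℕ) : K)⁻¹ •
        augMonomialSymm K ((setComp d T).blocks : Multiset ℕ) := by
  funext e
  rw [symmetrize_apply]
  change _ = (((setComp d T).length.factorial : ℕ) : K)⁻¹ *
    ((multFactorial (setComp d T).blocks : K) * monomialSymm K ((setComp d T).blocks : Multiset ℕ) e)
  simp only [quasiMono, monomialSymm]
  rw [← Nat.cast_sum, sum_ncard_ascents_mapDomain]
  split_ifs with h
  · have : e.support.card = (setComp d T).length := by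
      have := congrArg Multiset.card h
      simpa using this
    rw [this, mul_one]
  · simp

/-- The sequences counted by `Q_{S,d}` are sorted by their exact set of strict ascents, which can be
any `T` containing `S`. -/
theorem fundQ_eq_sum (q : FundIndex) :
    fundQ K q = ∑ T ∈ (Finset.Icc 1 (q.1 - 1)).powerset with q.2.1 ⊆ T, quasiMono K q.1 T := by
  classical
  obtain ⟨d, S, hS⟩ := q
  funext e
  rw [MvPowerSeries.sum_apply]
  simp only [fundQ, quasiMono]
  rw [← Nat.cast_sum]
  congr 1
  have hS' : S ⊆ Finset.Icc 1 (d - 1) := Finset.mem_powerset.1 hS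
  have hfin := finite_setOf_sum_single (α := Fin d) e
  let asc : (Fin d → ℕ) → Finset ℕ := fun i =>
    (Finset.univ.filter fun k : Fin d => ∃ l : Fin d, (k : ℕ) + 1 = l ∧ i k < i l).image
      fun k : Fin d => (k : ℕ) + 1
  have hasc : ∀ i k, k ∈ asc i ↔ ∃ (a b : Fin d), (a : ℕ) + 1 = b ∧ i a < i b ∧ (a : ℕ) + 1 = k := by
    intro i k
    simp only [asc, Finset.mem_image, Finset.mem_filter, Finset.mem_univ, true_and]
    constructor
    · rintro ⟨a, ⟨b, h1, h2⟩, rfl⟩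
      exact ⟨a, b, h1, h2, rfl⟩
    · rintro ⟨a, b, h1, h2, rfl⟩
      exact ⟨a, ⟨b, h1, h2⟩, rfl⟩
  have hasc_iff : ∀ (i : Fin d → ℕ) (T : Finset ℕ), T ⊆ Finset.Icc 1 (d - 1) →
      ((∀ k l : Fin d, (k : ℕ) + 1 = l → (i k < i l ↔ (k : ℕ) + 1 ∈ T)) ↔ asc i = T) := by
    intro i T hT
    constructor
    · intro h
      ext k
      rw [hasc]
      constructor
      · rintro ⟨a, b, h1, h2, rfl⟩
        exact (h a b h1).1 h2
      · intro hk
        have := Finset.mem_Icc.1 (hT hk)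
        refine ⟨⟨k - 1, by omega⟩, ⟨k, by omega⟩, by simp only; omega, ?_, by simp only; omega⟩
        refine (h _ _ (by simp only; omega)).2 ?_
        simp only
        convert hk using 1
        omega
    · rintro rfl k l hkl
      rw [hasc]
      constructor
      · exact fun h => ⟨k, l, hkl, h, rfl⟩
      · rintro ⟨a, b, h1, h2, h3⟩
        obtain rfl : a = k := Fin.ext (by omega)
        obtain rfl : b = l := Fin.ext (by omega)
        exact h2
  have hsub : ∀ i, asc i ⊆ Finset.Icc 1 (d - 1) := by
    intro i k hk
    obtain ⟨a, b, h1, -, rfl⟩ := (hasc i k).1 hk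
    have := b.2
    rw [Finset.mem_Icc]
    omega
  rw [Set.ncard_eq_toFinset_card _ (hfin.subset fun i hi => hi.2.2),
    Finset.card_eq_sum_card_fiberwise (f := asc)
      (t := {T ∈ (Finset.Icc 1 (d - 1)).powerset | S ⊆ T})]
  · refine Finset.sum_congr rfl fun T hT => ?_
    simp only [Finset.mem_filter, Finset.mem_powerset] at hT
    rw [← Set.ncard_coe_finset]
    congr 1
    ext i
    simp only [Finset.coe_filter, Set.Finite.mem_toFinset, Set.mem_ofPred_eq]
    rw [← hasc_iff i T hT.1]
    constructor
    · rintro ⟨⟨h1, -, h3⟩, h4⟩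
      exact ⟨h1, h4, h3⟩
    · rintro ⟨h1, h2, h3⟩
      exact ⟨⟨h1, fun k l hkl hk => (h2 k l hkl).2 (hT.2 hk), h3⟩, h2⟩
  · intro i hi
    simp only [Set.Finite.coe_toFinset, Set.mem_ofPred_eq] at hi
    simp only [Finset.coe_filter, Finset.mem_powerset, Set.mem_ofPred_eq]
    refine ⟨hsub i, fun k hk => ?_⟩
    have := Finset.mem_Icc.1 (hS' hk)
    rw [hasc]
    refine ⟨⟨k - 1, by omega⟩, ⟨k, by omega⟩, by simp only; omega, ?_, by simp only; omega⟩
    refine hi.2.1 _ _ (by simp only; omega) ?_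
    simp only
    convert hk using 1
    omega

theorem symmetrize_fundQ (q : FundIndex) :
    symmetrize K (fundQ K q) = ∑ T ∈ (Finset.Icc 1 (q.1 - 1)).powerset with q.2.1 ⊆ T,
      (((setComp q.1 T).length.factorial : ℕ) : K)⁻¹ •
        augMonomialSymm K ((setComp q.1 T).blocks : Multiset ℕ) := by
  rw [fundQ_eq_sum, map_sum]
  exact Finset.sum_congr rfl fun T _ => symmetrize_quasiMono _ T

end quasiMono

/-! ### Component sizes of subgraphs of paths. -/

section components

theorem mem_pathEdges {l : List ℕ} {u v : PathVertex l} :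
    (u, v) ∈ pathEdges l ↔ u.1 = v.1 ∧ (u.2 : ℕ) + 1 = v.2 := by
  classical
  exact Finset.mem_filter.trans (and_iff_right (Finset.mem_univ _))

theorem componentSizes_eq_map {V ι : Type*} [Fintype V] [Fintype ι] (F : Finset (V × V))
    (E : ι ≃ (SimpleGraph.fromRel fun u v => (u, v) ∈ F).ConnectedComponent) :
    componentSizes F = Finset.univ.val.map fun b => (E b).supp.ncard := by
  classical
  unfold componentSizes
  rw [← Finset.map_univ_equiv E, Finset.map_val, Multiset.map_map]
  rfl

theorem componentSizes_congr {V W : Type*} [Fintype V] [Fintype W] (E : V ≃ W)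
    {F : Finset (V × V)} {F' : Finset (W × W)}
    (h : ∀ u v, (u, v) ∈ F ↔ (E u, E v) ∈ F') : componentSizes F = componentSizes F' := by
  classical
  let φ : (SimpleGraph.fromRel fun u v => (u, v) ∈ F) ≃g
      (SimpleGraph.fromRel fun u v => (u, v) ∈ F') :=
    ⟨E, by intro a b; simp [SimpleGraph.fromRel_adj, h]⟩
  unfold componentSizes
  rw [← Finset.map_univ_equiv φ.connectedComponentEquiv, Finset.map_val, Multiset.map_map]
  refine Multiset.map_congr rfl fun c _ => ?_
  change c.supp.ncard = (φ.connectedComponentEquiv c).supp.ncard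
  have : (φ.connectedComponentEquiv c).supp = E '' c.supp := by
    induction c using SimpleGraph.ConnectedComponent.ind with | _ v =>
    ext w
    obtain ⟨u, rfl⟩ := E.surjective w
    rw [E.injective.mem_set_image]
    change SimpleGraph.connectedComponentMk _ (φ u) = SimpleGraph.connectedComponentMk _ (φ v) ↔ _
    rw [SimpleGraph.ConnectedComponent.eq, φ.reachable_iff, ← SimpleGraph.ConnectedComponent.eq]
    rfl
  rw [this, Set.ncard_image_of_injective _ E.injective]

/-- Two vertices are connected exactly when they lie on the same path. Positivity gives each path a
first vertex to represent its component. -/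
theorem componentSizes_pathEdges {l : List ℕ} (hl : ∀ n ∈ l, 0 < n) :
    componentSizes (pathEdges l) = l := by
  classical
  set G := SimpleGraph.fromRel fun u v : PathVertex l => (u, v) ∈ pathEdges l with hG
  have hpos : ∀ b : Fin l.length, 0 < l.get b := fun b => hl _ (List.get_mem l b)
  have hreach : ∀ (b : Fin l.length) (n : ℕ) (hn : n < l.get b),
      G.Reachable ⟨b, ⟨0, hpos b⟩⟩ ⟨b, ⟨n, hn⟩⟩ := by
    intro b n
    induction n with
    | zero => exact fun _ => SimpleGraph.Reachable.refl _
    | succ n ih =>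
      intro hn
      refine (ih (by omega)).trans (SimpleGraph.Adj.reachable ?_)
      rw [hG, SimpleGraph.fromRel_adj]
      exact ⟨by simp, Or.inl (mem_pathEdges.2 ⟨rfl, rfl⟩)⟩
  have hfst : ∀ u v, G.Reachable u v → u.1 = v.1 := by
    rintro u v ⟨p⟩
    induction p with
    | nil => rfl
    | cons hadj _ ih =>
      rw [← ih]
      rw [hG, SimpleGraph.fromRel_adj] at hadj
      rcases hadj.2 with h | h
      · exact (mem_pathEdges.1 h).1
      · exact (mem_pathEdges.1 h).1.symm
  have hiff : ∀ u v, G.Reachable u v ↔ u.1 = v.1 := by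
    refine fun u v => ⟨hfst u v, fun h => ?_⟩
    obtain ⟨b, m, hm⟩ := u
    obtain ⟨b', n, hn⟩ := v
    obtain rfl : b = b' := h
    exact (hreach b m hm).symm.trans (hreach b n hn)
  let E : Fin l.length ≃ G.ConnectedComponent := Equiv.ofBijective
    (fun b => G.connectedComponentMk ⟨b, ⟨0, hpos b⟩⟩) (by
      constructor
      · intro b b' h
        exact hfst _ _ (SimpleGraph.ConnectedComponent.eq.1 h)
      · intro c
        induction c using SimpleGraph.ConnectedComponent.ind with | _ v =>
        exact ⟨v.1, SimpleGraph.ConnectedComponent.eq.2 ((hiff _ _).2 rfl)⟩)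
  have : ∀ b : Fin l.length, (E b).supp.ncard = l.get b := by
    intro b
    have hs : (E b).supp = Set.range fun j : Fin (l.get b) => (⟨b, j⟩ : PathVertex l) := by
      ext v
      change G.connectedComponentMk v = G.connectedComponentMk _ ↔ _
      rw [SimpleGraph.ConnectedComponent.eq, hiff]
      constructor
      · obtain ⟨b', j⟩ := v
        rintro rfl
        exact ⟨j, rfl⟩
      · rintro ⟨j, rfl⟩
        rfl
    rw [hs, ← Set.image_univ, Set.ncard_image_of_injective
      (f := fun j : Fin (l.get b) => (⟨b, j⟩ : PathVertex l)) _ (by intro x y h; simpa using h),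
      Set.ncard_univ,
      Nat.card_eq_fintype_card, Fintype.card_fin]
  rw [show ((l : List ℕ) : Multiset ℕ) = (Finset.univ : Finset (Fin l.length)).val.map l.get by
    rw [Fin.univ_val_map, List.ofFn_get]]
  refine (componentSizes_eq_map _ E).trans ?_
  exact Multiset.map_congr rfl fun b _ => this b

theorem sum_powerset_componentSizes_congr {M : Type*} [AddCommMonoid M] {V W : Type*} [Fintype V]
    [Fintype W] (E : V ≃ W) {A : Finset (V × V)} {B : Finset (W × W)}
    (h : ∀ u v, (u, v) ∈ A ↔ (E u, E v) ∈ B) (f : Multiset ℕ → M) :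
    ∑ F ∈ A.powerset, f (componentSizes F) = ∑ F ∈ B.powerset, f (componentSizes F) := by
  classical
  have hB : B = A.map (E.prodCongr E).toEmbedding := by
    ext ⟨u, v⟩
    obtain ⟨u, rfl⟩ := E.surjective u
    obtain ⟨v, rfl⟩ := E.surjective v
    rw [← h]
    simp
  refine Finset.sum_bij (fun F _ => F.map (E.prodCongr E).toEmbedding) ?_ ?_ ?_ ?_
  · intro F hF
    rw [Finset.mem_powerset, hB]
    exact Finset.map_subset_map.2 (Finset.mem_powerset.1 hF)
  · intro F _ F' _ hFF
    exact Finset.map_injective _ hFF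
  · intro F hF
    rw [Finset.mem_powerset, hB, Finset.subset_map_iff] at hF
    obtain ⟨F', hF', rfl⟩ := hF
    exact ⟨F', Finset.mem_powerset.2 hF', rfl⟩
  · intro F _
    refine congrArg f (componentSizes_congr E fun u v => ?_)
    simp

/-- This makes the sorting of the parts in the definition of `xi` harmless: the paths may be listed
in the order of a composition. -/
theorem exists_pathVertex_equiv {l l' : List ℕ} (h : l.Perm l') :
    ∃ E : PathVertex l ≃ PathVertex l',
      ∀ u v, (u, v) ∈ pathEdges l ↔ (E u, E v) ∈ pathEdges l' := by
  obtain ⟨e, he⟩ : ∃ e : Fin l.length ≃ Fin l'.length, ∀ b, l'.get (e b) = l.get b := by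
    apply exists_equiv_comp_eq
    rw [Fin.univ_val_map, Fin.univ_val_map, List.ofFn_get, List.ofFn_get]
    exact Quotient.sound h.symm
  refine ⟨Equiv.sigmaCongr e fun b => finCongr (he b).symm, ?_⟩
  rintro ⟨b, j⟩ ⟨b', j'⟩
  rw [mem_pathEdges, mem_pathEdges]
  change (b = b' ∧ (j : ℕ) + 1 = j') ↔ (e b = e b' ∧ (j : ℕ) + 1 = j')
  rw [e.injective.eq_iff]

open Classical in
/-- The edges of the directed path on `d` vertices that do not leave the vertex with (one-based)
number in `T`. -/
def cutPathEdges (d : ℕ) (T : Finset ℕ) : Finset (Fin d × Fin d) :=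
  Finset.univ.filter fun p => (p.1 : ℕ) + 1 = p.2 ∧ (p.1 : ℕ) + 1 ∉ T

theorem mem_cutPathEdges {d : ℕ} {T : Finset ℕ} {p : Fin d × Fin d} :
    p ∈ cutPathEdges d T ↔ (p.1 : ℕ) + 1 = p.2 ∧ (p.1 : ℕ) + 1 ∉ T := by
  simp [cutPathEdges]

/-- Consecutive vertices of the long path stay joined exactly when no break separates their blocks,
so the cut path is the disjoint union of the paths given by the blocks. -/
theorem mem_pathEdges_iff_mem_cutPathEdges {d : ℕ} {T : Finset ℕ} (c : Composition d)
    (hc : ∀ k l : Fin d, (k : ℕ) + 1 = l → (c.index k < c.index l ↔ (k : ℕ) + 1 ∈ T))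
    (u v : PathVertex c.blocks) :
    (u, v) ∈ pathEdges c.blocks ↔ (c.blocksFinEquiv u, c.blocksFinEquiv v) ∈ cutPathEdges d T := by
  rw [mem_pathEdges, mem_cutPathEdges]
  obtain ⟨b, j⟩ := u
  obtain ⟨b', j'⟩ := v
  change b = b' ∧ (j : ℕ) + 1 = j' ↔ (c.embedding b j : ℕ) + 1 = c.embedding b' j' ∧
    (c.embedding b j : ℕ) + 1 ∉ T
  have hb := c.index_embedding b j
  have hb' := c.index_embedding b' j'
  constructor
  · rintro ⟨rfl, h2⟩
    have h3 : (c.embedding b j : ℕ) + 1 = c.embedding b j' := by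
      exact (congrArg (c.sizeUpTo b + ·) h2 : c.sizeUpTo b + ((j : ℕ) + 1) = c.sizeUpTo b + j')
    refine ⟨h3, fun hT => ?_⟩
    have := (hc _ _ h3).2 hT
    rw [hb, hb'] at this
    exact lt_irrefl _ this
  · rintro ⟨h1, h2⟩
    have h3 := (hc _ _ h1).not.2 h2
    have h4 : c.index (c.embedding b j) ≤ c.index (c.embedding b' j') := by
      apply c.index_mono
      rw [Fin.le_def]
      omega
    rw [hb, hb'] at h3 h4
    obtain rfl : b = b' := le_antisymm h4 (not_lt.1 h3)
    refine ⟨rfl, ?_⟩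
    exact Nat.add_left_cancel (h1 : c.sizeUpTo b + ((j : ℕ) + 1) = c.sizeUpTo b + j')

theorem componentSizes_cutPathEdges (d : ℕ) (T : Finset ℕ) :
    componentSizes (cutPathEdges d T) = (setComp d T).blocks := by
  rw [← componentSizes_pathEdges fun n hn => (setComp d T).blocks_pos hn]
  exact (componentSizes_congr (V := PathVertex (setComp d T).blocks) (setComp d T).blocksFinEquiv
    (mem_pathEdges_iff_mem_cutPathEdges _ (setComp_index_lt_iff d T))).symm

theorem sum_powerset_cutPathEdges {M : Type*} [AddCommMonoid M] (d : ℕ) (S : Finset ℕ)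
    (hS : S ⊆ Finset.Icc 1 (d - 1)) (f : Multiset ℕ → M) :
    ∑ F ∈ (cutPathEdges d S).powerset, f (componentSizes F) =
      ∑ T ∈ (Finset.Icc 1 (d - 1)).powerset with S ⊆ T, f (setComp d T).blocks := by
  classical
  symm
  refine Finset.sum_bij (fun T _ => cutPathEdges d T) ?_ ?_ ?_ ?_
  · intro T hT
    rw [Finset.mem_filter] at hT
    rw [Finset.mem_powerset]
    intro p hp
    rw [mem_cutPathEdges] at hp ⊢
    exact ⟨hp.1, fun h => hp.2 (hT.2 h)⟩
  · have key : ∀ T T' : Finset ℕ, T ⊆ Finset.Icc 1 (d - 1) →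
        cutPathEdges d T = cutPathEdges d T' → T' ∩ Finset.Icc 1 (d - 1) ⊆ T := by
      intro T T' hT h k hk
      rw [Finset.mem_inter, Finset.mem_Icc] at hk
      by_contra hkT
      have : ((⟨k - 1, by omega⟩, ⟨k, by omega⟩) : Fin d × Fin d) ∈ cutPathEdges d T := by
        rw [mem_cutPathEdges]
        simp only
        rw [Nat.sub_add_cancel hk.2.1]
        exact ⟨rfl, hkT⟩
      rw [h, mem_cutPathEdges] at this
      simp only [Nat.sub_add_cancel hk.2.1] at this
      exact this.2 hk.1
    intro T hT T' hT' h
    rw [Finset.mem_filter, Finset.mem_powerset] at hT hT'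
    apply Finset.Subset.antisymm
    · exact fun k hk => key T' T hT'.1 h.symm (Finset.mem_inter.2 ⟨hk, hT.1 hk⟩)
    · exact fun k hk => key T T' hT.1 h (Finset.mem_inter.2 ⟨hk, hT'.1 hk⟩)
  · intro F hF
    rw [Finset.mem_powerset] at hF
    -- The inverse map: `T` consists of the positions whose edge is missing from `F`.
    refine ⟨(Finset.Icc 1 (d - 1)).filter fun k => ¬ ∃ p ∈ F, (p.1 : ℕ) + 1 = k, ?_, ?_⟩
    · rw [Finset.mem_filter, Finset.mem_powerset]
      refine ⟨Finset.filter_subset _ _, fun k hk => Finset.mem_filter.2 ⟨hS hk, ?_⟩⟩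
      rintro ⟨p, hp, rfl⟩
      exact (mem_cutPathEdges.1 (hF hp)).2 hk
    · ext p
      rw [mem_cutPathEdges, Finset.mem_filter, Finset.mem_Icc]
      constructor
      · rintro ⟨h1, h2⟩
        have := p.2.2
        rw [not_and, not_not] at h2
        obtain ⟨q, hq, hqp⟩ := h2 (by omega)
        have hq1 := (mem_cutPathEdges.1 (hF hq)).1
        have : q = p := Prod.ext (Fin.ext (by omega)) (Fin.ext (by omega))
        exact this ▸ hq
      · intro hp
        refine ⟨(mem_cutPathEdges.1 (hF hp)).1, fun h => h.2 ⟨p, hp, rfl⟩⟩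
  · intro T _
    rw [componentSizes_cutPathEdges]

end components

/-! ### The symmetrization of `Q_{S,d}` is `ξ_{type(S)}`. -/

section xi

variable {K : Type*} [Field K]

theorem xi_subsetType (d : ℕ) (S : Finset ℕ) (hS : S ⊆ Finset.Icc 1 (d - 1)) :
    xi K ⟨d, subsetType d S⟩ = ∑ T ∈ (Finset.Icc 1 (d - 1)).powerset with S ⊆ T,
      (((setComp d T).length.factorial : ℕ) : K)⁻¹ •
        augMonomialSymm K ((setComp d T).blocks : Multiset ℕ) := by
  have hperm : ((subsetType d S).parts.sort (· ≥ ·)).Perm (setComp d S).blocks := by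
    rw [← Multiset.coe_eq_coe, Multiset.sort_eq, subsetType_parts]
  obtain ⟨E, hE⟩ := exists_pathVertex_equiv hperm
  let f : Multiset ℕ → MvPowerSeries ℕ K := fun m =>
    ((m.card.factorial : ℕ) : K)⁻¹ • augMonomialSymm K m
  exact (sum_powerset_componentSizes_congr E hE f).trans
    ((sum_powerset_componentSizes_congr (V := PathVertex (setComp d S).blocks)
      (setComp d S).blocksFinEquiv (mem_pathEdges_iff_mem_cutPathEdges _ (setComp_index_lt_iff d S)) f).trans
      (sum_powerset_cutPathEdges d S hS f))

theorem symmetrize_fundQ_eq_xi (q : FundIndex) :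
    symmetrize K (fundQ K q) = xi K ⟨q.1, subsetType q.1 q.2.1⟩ := by
  rw [symmetrize_fundQ, xi_subsetType _ _ (Finset.mem_powerset.1 q.2.2)]

end xi

/-! ### Linear independence of the `ξ_λ`. -/

section linearIndependence

variable {K : Type*} [Field K]

/-- The parts, listed in any order, form a composition, and `S` is its set of breaks. The type of
`S` is identified by comparing component sizes of the same cut path. -/
theorem exists_subsetType_eq {d : ℕ} (p : Nat.Partition d) :
    ∃ S ⊆ Finset.Icc 1 (d - 1), subsetType d S = p := by
  classical
  obtain ⟨l, hl⟩ := Quot.exists_rep p.parts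
  replace hl : (l : Multiset ℕ) = p.parts := hl
  let c : Composition d := ⟨l, fun {i} hi => p.parts_pos (by rw [← hl]; exact hi), by
    rw [← Multiset.sum_coe, hl, p.parts_sum]⟩
  let S := (Finset.Icc 1 (d - 1)).filter fun k => ∃ a b : Fin d, (a : ℕ) + 1 = b ∧ (a : ℕ) + 1 = k ∧
    c.index a < c.index b
  have hS : ∀ a b : Fin d, (a : ℕ) + 1 = b → (c.index a < c.index b ↔ (a : ℕ) + 1 ∈ S) := by
    intro a b hab
    simp only [S, Finset.mem_filter, Finset.mem_Icc]
    constructor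
    · intro h
      have := b.2
      exact ⟨by omega, a, b, hab, rfl, h⟩
    · rintro ⟨-, a', b', h1, h2, h3⟩
      obtain rfl : a' = a := Fin.ext (by omega)
      obtain rfl : b' = b := Fin.ext (by omega)
      exact h3
  refine ⟨S, Finset.filter_subset _ _, Nat.Partition.ext ?_⟩
  rw [subsetType_parts, ← componentSizes_cutPathEdges, ← hl,
    ← componentSizes_pathEdges fun n hn => c.blocks_pos hn]
  exact (componentSizes_congr (V := PathVertex c.blocks) c.blocksFinEquiv
    (mem_pathEdges_iff_mem_cutPathEdges c hS)).symm

/-- More breaks give a finer composition, so each block for `T` lies in one block for `S`. -/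
theorem exists_surjective_comp_index {d : ℕ} {S T : Finset ℕ} (hST : S ⊆ T) :
    ∃ π : Fin (setComp d T).length → Fin (setComp d S).length, Function.Surjective π ∧
      ∀ k, π ((setComp d T).index k) = (setComp d S).index k := by
  obtain ⟨s, hs⟩ := (setComp d T).index_surjective.hasRightInverse
  have key : ∀ k l, (setComp d S).index k < (setComp d S).index l →
      (setComp d T).index k < (setComp d T).index l := fun k l =>
    lt_of_lt_of_succ (setComp d S).index_mono (setComp d T).index_mono fun k l hkl h => by
      rw [setComp_index_lt_iff _ _ _ _ hkl] at h ⊢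
      exact hST h
  have hπ : ∀ k, (setComp d S).index (s ((setComp d T).index k)) = (setComp d S).index k := by
    intro k
    refine le_antisymm (not_lt.1 fun h => ?_) (not_lt.1 fun h => ?_)
    · have := key _ _ h
      rw [hs] at this
      exact lt_irrefl _ this
    · have := key _ _ h
      rw [hs] at this
      exact lt_irrefl _ this
  refine ⟨(setComp d S).index ∘ s, fun b => ?_, hπ⟩
  obtain ⟨k, rfl⟩ := (setComp d S).index_surjective b
  exact ⟨_, hπ k⟩

theorem setComp_length_le {d : ℕ} {S T : Finset ℕ} (hST : S ⊆ T) :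
    (setComp d S).length ≤ (setComp d T).length := by
  obtain ⟨π, hπ, -⟩ := exists_surjective_comp_index (d := d) hST
  simpa using Fintype.card_le_of_surjective π hπ

/-- With equally many blocks the surjection from finer to coarser blocks is a bijection, so no break
of `T` is lost in `S`. -/
theorem eq_of_setComp_length_eq {d : ℕ} {S T : Finset ℕ} (hST : S ⊆ T)
    (hT : T ⊆ Finset.Icc 1 (d - 1)) (h : (setComp d S).length = (setComp d T).length) :
    S = T := by
  obtain ⟨π, hπ, hπi⟩ := exists_surjective_comp_index (d := d) hST
  have hinj : Function.Injective π :=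
    ((Fintype.bijective_iff_surjective_and_card π).2 ⟨hπ, by simpa using h.symm⟩).1
  refine Finset.Subset.antisymm hST fun k hk => ?_
  have hk' := Finset.mem_Icc.1 (hT hk)
  have hcons : ((⟨k - 1, by omega⟩ : Fin d) : ℕ) + 1 = (⟨k, by omega⟩ : Fin d) := by
    simp only; omega
  have hk1 : k - 1 + 1 = k := by omega
  have h1 := (setComp_index_lt_iff d T _ _ hcons).2 (by simpa only [hk1] using hk)
  have h2 : (setComp d S).index ⟨k - 1, by omega⟩ < (setComp d S).index ⟨k, by omega⟩ := by
    refine lt_of_le_of_ne ((setComp d S).index_mono ?_) fun heq => ?_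
    · rw [Fin.le_def]; simp
    · rw [← hπi, ← hπi] at heq
      exact h1.ne (hinj heq)
  have := (setComp_index_lt_iff d S _ _ hcons).1 h2
  simpa only [hk1] using this

theorem augMonomialSymm_apply (s : Multiset ℕ) (e : ℕ →₀ ℕ) :
    augMonomialSymm K s e = if e.support.val.map e = s then (multFactorial s : K) else 0 := by
  change (multFactorial s : K) * (if e.support.val.map e = s then 1 else 0) = _
  split_ifs <;> simp

theorem xi_subsetType_apply (d : ℕ) (S : Finset ℕ) (hS : S ⊆ Finset.Icc 1 (d - 1)) (e : ℕ →₀ ℕ) :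
    xi K ⟨d, subsetType d S⟩ e = ∑ T ∈ (Finset.Icc 1 (d - 1)).powerset with S ⊆ T,
      (((setComp d T).length.factorial : ℕ) : K)⁻¹ *
        if e.support.val.map e = ((setComp d T).blocks : Multiset ℕ) then
          (multFactorial (setComp d T).blocks : K) else 0 := by
  rw [xi_subsetType d S hS, MvPowerSeries.sum_apply]
  exact Finset.sum_congr rfl fun T _ => congrArg
    ((((setComp d T).length.factorial : ℕ) : K)⁻¹ * ·) (augMonomialSymm_apply _ e)

theorem multFactorial_ne_zero (s : Multiset ℕ) : multFactorial s ≠ 0 :=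
  Finset.prod_ne_zero_iff.2 fun _ _ => Nat.factorial_ne_zero _

/-- The diagonal entry: every `T` properly containing `S` has more blocks, so only `T = S`
contributes, and a quotient of factorials is nonzero in characteristic zero. -/
theorem xi_apply_self_ne_zero [CharZero K] {d : ℕ} (p : Nat.Partition d) {e : ℕ →₀ ℕ}
    (he : e.support.val.map e = p.parts) : xi K ⟨d, p⟩ e ≠ 0 := by
  classical
  obtain ⟨S, hS, rfl⟩ := exists_subsetType_eq p
  rw [xi_subsetType_apply d S hS, Finset.sum_eq_single S]
  · rw [if_pos (he.trans (subsetType_parts d S))]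
    refine mul_ne_zero (inv_ne_zero ?_) ?_
    · exact_mod_cast Nat.factorial_ne_zero _
    · exact_mod_cast multFactorial_ne_zero _
  · intro T hT hne
    rw [Finset.mem_filter, Finset.mem_powerset] at hT
    rw [if_neg, mul_zero]
    intro h
    refine hne (eq_of_setComp_length_eq hT.2 hT.1 ?_).symm
    exact congrArg Multiset.card (he.symm.trans h)
  · intro h
    exact absurd (Finset.mem_filter.2 ⟨Finset.mem_powerset.2 hS, Finset.Subset.refl S⟩) h

/-- The triangularity: a monomial of `ξ_λ` comes from a refinement of `λ`, and a refinement with no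
more parts than `λ` is `λ` itself. -/
theorem parts_eq_of_xi_apply_ne_zero {d : ℕ} (p : Nat.Partition d) {e : ℕ →₀ ℕ}
    (h : xi K ⟨d, p⟩ e ≠ 0) (hcard : e.support.card ≤ p.parts.card) :
    p.parts = e.support.val.map e := by
  obtain ⟨S, hS, rfl⟩ := exists_subsetType_eq p
  rw [xi_subsetType_apply d S hS] at h
  obtain ⟨T, hT, hne⟩ := Finset.exists_ne_zero_of_sum_ne_zero h
  rw [Finset.mem_filter, Finset.mem_powerset] at hT
  have hT' : e.support.val.map e = ((setComp d T).blocks : Multiset ℕ) := by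
    by_contra hne'
    rw [if_neg hne', mul_zero] at hne
    exact hne rfl
  have hlen : e.support.card = (setComp d T).length := by
    simpa using congrArg Multiset.card hT'
  have : S = T := eq_of_setComp_length_eq hT.2 hT.1
    (le_antisymm (setComp_length_le hT.2) (hlen ▸ hcard))
  rw [subsetType_parts, this, hT']

theorem exists_map_support_eq (s : Multiset ℕ) (hs : ∀ n ∈ s, 0 < n) :
    ∃ e : ℕ →₀ ℕ, e.support.val.map e = s := by
  obtain ⟨l, rfl⟩ := Quot.exists_rep s
  refine ⟨∑ b : Fin l.length, Finsupp.single (b : ℕ) (l.get b), ?_⟩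
  obtain ⟨h1, h2⟩ := (sum_single_eq_iff (r := l.length) (φ := fun b => (b : ℕ))
    Fin.val_injective l.get (fun b => hs _ (List.get_mem l b)) _).1 rfl
  set f : ℕ →₀ ℕ := ∑ b : Fin l.length, Finsupp.single (b : ℕ) (l.get b)
  have h3 : f.support = (Finset.univ : Finset (Fin l.length)).map Fin.valEmbedding := by
    rw [← Finset.coe_inj, ← h1]
    simp
  rw [h3, Finset.map_val, Multiset.map_map]
  change Finset.univ.val.map (fun b : Fin l.length => f b) = _
  rw [Multiset.map_congr rfl fun b _ => h2 b, Fin.univ_val_map, List.ofFn_get]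
  rfl

theorem sigma_partition_ext {p q : Σ d : ℕ, Nat.Partition d} (h : p.2.parts = q.2.parts) :
    p = q := by
  obtain ⟨d, p⟩ := p
  obtain ⟨d', q⟩ := q
  obtain rfl : d = d' := by rw [← p.parts_sum, ← q.parts_sum]; exact congrArg _ h
  exact congrArg _ (Nat.Partition.ext h)

theorem linearCombination_apply_apply {ι : Type*} (v : ι → MvPowerSeries ℕ K) (a : ι →₀ K)
    (e : ℕ →₀ ℕ) : Finsupp.linearCombination K v a e = ∑ i ∈ a.support, a i * v i e := by
  rw [Finsupp.linearCombination_apply, Finsupp.sum, MvPowerSeries.sum_apply]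
  rfl

theorem linearIndependent_xi [CharZero K] : LinearIndependent K (xi K) := by
  rw [linearIndependent_iff]
  intro a ha
  by_contra hne
  -- At a monomial whose exponents are the parts of a shortest partition in the support, only that
  -- partition contributes.
  obtain ⟨p, hp, hmin⟩ := Finset.exists_min_image a.support
    (fun p : Σ d : ℕ, Nat.Partition d => p.2.parts.card) (Finsupp.support_nonempty_iff.2 hne)
  obtain ⟨e, he⟩ := exists_map_support_eq p.2.parts fun n hn => p.2.parts_pos hn
  have h0 : Finsupp.linearCombination K (xi K) a e = 0 := by rw [ha]; rfl
  rw [linearCombination_apply_apply, Finset.sum_eq_single p] at h0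
  · exact (mul_ne_zero (Finsupp.mem_support_iff.1 hp) (xi_apply_self_ne_zero p.2 he)) h0
  · intro q hq hqp
    by_contra hq0
    refine hqp (sigma_partition_ext ?_)
    rw [← he]
    refine parts_eq_of_xi_apply_ne_zero q.2 (right_ne_zero_of_mul hq0) ?_
    refine le_trans (le_of_eq ?_) (hmin q hq)
    simpa using congrArg Multiset.card he
  · exact fun h => absurd hp h

end linearIndependence

/-! ### Coefficients of `X_G` as numbers of proper colorings. -/

section colorings

variable {V : Type*} [Fintype V]

theorem exists_equiv_eq_comp {V A B : Type*} {q : V → A} {r : V → B} (hq : Function.Surjective q)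
    (hr : Function.Surjective r) (h : ∀ u v, r u = r v ↔ q u = q v) :
    ∃ ψ : A ≃ B, ∀ v, ψ (q v) = r v := by
  choose s hs using hq
  refine ⟨Equiv.ofBijective (fun a => r (s a)) ⟨fun a b hab => ?_, fun b => ?_⟩, fun v => ?_⟩
  · rw [← hs a, ← hs b]
    exact (h _ _).1 hab
  · obtain ⟨v, rfl⟩ := hr b
    exact ⟨q v, (h _ _).2 (hs _)⟩
  · exact (h _ _).2 (hs _)

/-- The number of colorings with prescribed content and prescribed partition into color classes. -/
theorem ncard_colorings_of_ker {A : Type*} [Fintype A] {q : V → A}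
    (hq : Function.Surjective q) (e : ℕ →₀ ℕ) :
    Set.ncard {κ : V → ℕ | (∀ u v, κ u = κ v ↔ q u = q v) ∧ ∑ v, Finsupp.single (κ v) 1 = e} =
      Nat.card {ψ : A ≃ e.support // ∀ a, e (ψ a) = Nat.card {v // q v = a}} := by
  classical
  have hmaps : ∀ ψ : {ψ : A ≃ e.support // ∀ a, e (ψ a) = Nat.card {v // q v = a}},
      (fun v => (ψ.1 (q v) : ℕ)) ∈ {κ : V → ℕ | (∀ u v, κ u = κ v ↔ q u = q v) ∧
        ∑ v, Finsupp.single (κ v) 1 = e} := by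
    intro ψ
    refine ⟨fun u v => ?_, ?_⟩
    · rw [Subtype.coe_inj, ψ.1.injective.eq_iff]
    · ext x
      rw [sum_single_apply]
      by_cases hx : x ∈ e.support
      · obtain ⟨a, ha⟩ := ψ.1.surjective ⟨x, hx⟩
        have hxa : x = ψ.1 a := by rw [ha]
        rw [hxa, ψ.2 a, Nat.card_eq_fintype_card]
        refine Fintype.card_congr (Equiv.subtypeEquivRight fun v => ?_)
        rw [Subtype.coe_inj, ψ.1.injective.eq_iff]
      · rw [Finsupp.notMem_support_iff.1 hx, Fintype.card_eq_zero_iff]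
        exact ⟨fun v => hx (v.2 ▸ (ψ.1 (q v.1)).2)⟩
  symm
  refine Nat.card_congr (Equiv.ofBijective (fun ψ => ⟨_, hmaps ψ⟩) ⟨?_, ?_⟩)
  · intro ψ ψ' h
    refine Subtype.ext (Equiv.ext fun a => Subtype.ext ?_)
    obtain ⟨v, rfl⟩ := hq a
    exact congrFun (congrArg Subtype.val h) v
  · rintro ⟨κ, hκ, rfl⟩
    set e : ℕ →₀ ℕ := ∑ v, Finsupp.single (κ v) 1 with he
    have hmem : ∀ x, x ∈ e.support ↔ ∃ v, κ v = x := by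
      intro x
      rw [Finsupp.mem_support_iff, he, sum_single_apply, ← Nat.pos_iff_ne_zero,
        Fintype.card_pos_iff, nonempty_subtype]
    obtain ⟨ψ, hψ⟩ := exists_equiv_eq_comp (q := q)
      (r := fun v => (⟨κ v, (hmem _).2 ⟨v, rfl⟩⟩ : e.support)) hq
      (by
        rintro ⟨x, hx⟩
        obtain ⟨v, rfl⟩ := (hmem x).1 hx
        exact ⟨v, rfl⟩)
      (fun u v => by rw [Subtype.mk.injEq]; exact hκ u v)
    refine ⟨⟨ψ, fun a => ?_⟩, ?_⟩
    · obtain ⟨u, rfl⟩ := hq a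
      rw [hψ, Nat.card_eq_fintype_card]
      refine (sum_single_apply κ (κ u)).trans ?_
      exact Fintype.card_congr (Equiv.subtypeEquivRight fun v => hκ v u)
    · refine Subtype.ext (funext fun v => ?_)
      change ((ψ (q v) : e.support) : ℕ) = κ v
      rw [hψ]

/-- The proper colorings of `G` with content `e`. -/
def properColorings (G : SimpleGraph V) (e : ℕ →₀ ℕ) : Set (V → ℕ) :=
  {κ | (∀ u v, G.Adj u v → κ u ≠ κ v) ∧ ∑ v, Finsupp.single (κ v) 1 = e}

theorem finite_properColorings (G : SimpleGraph V) (e : ℕ →₀ ℕ) : (properColorings G e).Finite :=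
  (finite_setOf_sum_single e).subset fun _ h => h.2

open Classical in
-- A partition is determined by when two vertices share a block. This form fits
-- `ncard_colorings_of_ker`, with `π.part` as the quotient map.
theorem Finpartition.ofSetoid_ker_eq_iff (κ : V → ℕ) (π : Finpartition (Finset.univ : Finset V)) :
    Finpartition.ofSetoid (Setoid.ker κ) = π ↔ ∀ u v, κ u = κ v ↔ π.part u = π.part v := by
  have hpart : ∀ (π : Finpartition (Finset.univ : Finset V)) (u v : V),
      π.part u = π.part v ↔ v ∈ π.part u := by
    intro π u v
    rw [π.mem_part_iff_part_eq_part (Finset.mem_univ _) (Finset.mem_univ _), eq_comm]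
  constructor
  · rintro rfl u v
    rw [hpart, Finpartition.mem_part_ofSetoid_iff_rel]
    rfl
  · intro h
    have hsame : ∀ u, (Finpartition.ofSetoid (Setoid.ker κ)).part u = π.part u := by
      intro u
      ext v
      rw [Finpartition.mem_part_ofSetoid_iff_rel, ← hpart, ← h]
      rfl
    have himage : ∀ π : Finpartition (Finset.univ : Finset V),
        π.parts = Finset.univ.image π.part := by
      intro π
      ext B
      rw [Finset.mem_image]
      constructor
      · intro hB
        obtain ⟨v, hv⟩ := π.nonempty_of_mem_parts hB
        exact ⟨v, Finset.mem_univ _, π.part_eq_of_mem hB hv⟩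
      · rintro ⟨v, hv, rfl⟩
        exact π.part_mem.2 hv
    apply Finpartition.ext
    rw [himage, himage π, funext hsame]

open Classical in
theorem ncard_colorings_of_finpartition (π : Finpartition (Finset.univ : Finset V))
    (e : ℕ →₀ ℕ) :
    Set.ncard {κ : V → ℕ | (∀ u v, κ u = κ v ↔ π.part u = π.part v) ∧
      ∑ v, Finsupp.single (κ v) 1 = e} =
      if e.support.val.map e = π.parts.val.map Finset.card then
        multFactorial (π.parts.val.map Finset.card) else 0 := by
  let q : V → π.parts := fun v => ⟨π.part v, π.part_mem.2 (Finset.mem_univ v)⟩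
  have hq : Function.Surjective q := by
    rintro ⟨B, hB⟩
    obtain ⟨v, hv⟩ := π.nonempty_of_mem_parts hB
    exact ⟨v, Subtype.ext (π.part_eq_of_mem hB hv)⟩
  have hcard : ∀ B : π.parts, Nat.card {v // q v = B} = B.1.card := by
    rintro ⟨B, hB⟩
    rw [Nat.card_eq_fintype_card, Fintype.card_subtype]
    congr 1
    ext v
    rw [Finset.mem_filter, and_iff_right (Finset.mem_univ v), ← π.part_eq_iff_mem hB]
    exact Subtype.mk_eq_mk
  have hmap : π.parts.val.map Finset.card =
      (Finset.univ : Finset π.parts).val.map fun B => B.1.card := by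
    conv_lhs => rw [← Multiset.attach_map_val π.parts.val, Multiset.map_map]
    rfl
  have h := ncard_colorings_of_ker hq e
  simp only [hcard] at h
  rw [hmap, map_support_eq, ← card_equiv_comp_eq, ← h]
  congr 1
  ext κ
  refine and_congr_left fun _ => forall₂_congr fun u v => ?_
  exact iff_congr Iff.rfl Subtype.mk_eq_mk.symm

/-- The coefficients of Stanley's chromatic symmetric function count proper colorings. -/
theorem chromaticSymm_apply (K : Type*) [Field K] (G : SimpleGraph V) (e : ℕ →₀ ℕ) :
    chromaticSymm K G e = ((properColorings G e).ncard : K) := by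
  classical
  unfold chromaticSymm
  rw [MvPowerSeries.sum_apply]
  have h1 : ∀ π : Finpartition (Finset.univ : Finset V),
      augMonomialSymm K (π.parts.val.map Finset.card) e =
      ((Set.ncard {κ : V → ℕ | (∀ u v, κ u = κ v ↔ π.part u = π.part v) ∧
        ∑ v, Finsupp.single (κ v) 1 = e} : ℕ) : K) := by
    intro π
    rw [augMonomialSymm_apply, ncard_colorings_of_finpartition]
    split_ifs <;> simp
  rw [Finset.sum_congr rfl fun π _ => h1 π, ← Nat.cast_sum]
  congr 1
  -- Proper colorings are sorted by their partition into color classes, which are stable sets.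
  rw [Set.ncard_eq_toFinset_card _ (finite_properColorings G e),
    Finset.card_eq_sum_card_fiberwise (f := fun κ => Finpartition.ofSetoid (Setoid.ker κ))
      (t := {π | ∀ B : Finset V, B ∈ π.parts → G.IsIndepSet (B : Set V)})]
  · refine Finset.sum_congr rfl fun π hπ => ?_
    rw [Finset.mem_filter] at hπ
    rw [← Set.ncard_coe_finset]
    congr 1
    ext κ
    simp only [Finset.coe_filter, Set.Finite.mem_toFinset, Set.mem_ofPred_eq,
      Finpartition.ofSetoid_ker_eq_iff]
    constructor
    · rintro ⟨h1, h2⟩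
      refine ⟨⟨fun u v huv heq => ?_, h2⟩, h1⟩
      have hu : u ∈ π.part u := π.mem_part (Finset.mem_univ u)
      have hv : v ∈ π.part u := by
        rw [(h1 u v).1 heq]
        exact π.mem_part (Finset.mem_univ v)
      exact hπ.2 _ (π.part_mem.2 (Finset.mem_univ u)) hu hv huv.ne huv
    · rintro ⟨h1, h2⟩
      exact ⟨h2, h1.2⟩
  · intro κ hκ
    rw [Finset.mem_coe, Set.Finite.mem_toFinset] at hκ
    rw [Finset.mem_coe, Finset.mem_filter]
    refine ⟨Finset.mem_univ _, fun B hB u hu v hv _ huv => hκ.1 u v huv ?_⟩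
    have := (Finpartition.ofSetoid_ker_eq_iff κ _).1 rfl u v
    rw [this, Finpartition.part_eq_of_mem _ hB hu, Finpartition.part_eq_of_mem _ hB hv]

end colorings

/-! ### Vertex orders, descents and the `Q`-expansion of `X_G`. -/

section descents

variable {V : Type*} [Fintype V]

theorem exists_equiv_fin_lt_iff {A : Type*} [LinearOrder A] {key : V → A}
    (h : Function.Injective key) :
    ∃ w : V ≃ Fin (Fintype.card V), ∀ u v, w u < w v ↔ key u < key v := by
  let := LinearOrder.lift' key h
  let o := Fintype.orderIsoFinOfCardEq V rfl
  exact ⟨o.symm.toEquiv, fun u v => o.symm.lt_iff_lt⟩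

theorem equiv_fin_unique {V : Type*} {n : ℕ} {w w' : V ≃ Fin n} (h : ∀ u v, w u < w v ↔ w' u < w' v) :
    w = w' := by
  have : StrictMono (w.symm.trans w') := fun a b hab => by
    simp only [Equiv.trans_apply]
    rw [← h]
    simpa using hab
  have hid : (w.symm.trans w' : Fin n → Fin n) = id := by
    let o : Fin n ≃o Fin n := this.orderIsoOfSurjective _ (Equiv.surjective _)
    have : o = OrderIso.refl _ := Subsingleton.elim _ _
    funext a
    exact congrArg (fun f : Fin n ≃o Fin n => f a) this
  ext v
  have := congrFun hid (w v)
  simp only [Equiv.trans_apply, Equiv.symm_apply_apply, id] at this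
  rw [this]

open Classical in
/-- An injective labelling of the vertices that decreases along the relation `R`, if there is
one. -/
def reverseLabel {V : Type*} (R : V → V → Prop) : V → ℕ :=
  -- The default `0` is never reached for orientation labels on a finite vertex set: a function
  -- increasing along `R` provides a labelling. Choosing from `R` alone makes the label depend only
  -- on the orientation.
  if h : ∃ ω : V → ℕ, Function.Injective ω ∧ ∀ u v, R u v → ω v < ω u then h.choose else 0

theorem reverseLabel_spec {R : V → V → Prop} (f : V → ℕ) (hf : ∀ u v, R u v → f u < f v) :
    Function.Injective (reverseLabel R) ∧
      ∀ u v, R u v → reverseLabel R v < reverseLabel R u := by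
  have h : ∃ ω : V → ℕ, Function.Injective ω ∧ ∀ u v, R u v → ω v < ω u := by
    obtain ⟨w, hw⟩ := exists_equiv_fin_lt_iff
      -- Decreasing `f` comes first; an arbitrary enumeration breaks ties.
      (key := fun v => toLex (OrderDual.toDual (f v), Fintype.equivFin V v)) (by
        intro u v huv
        have := congrArg (fun x => (ofLex x).2) huv
        exact (Fintype.equivFin V).injective this)
    refine ⟨fun v => w v, fun u v huv => w.injective (Fin.ext huv), fun u v huv => ?_⟩
    exact (hw v u).2 (Prod.Lex.toLex_lt_toLex.2 (Or.inl (hf u v huv)))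
  unfold reverseLabel
  rw [dif_pos h]
  exact h.choose_spec

/-- The labelling of the vertices that belongs to the acyclic orientation of `G` along which `f`
increases. -/
def orientationLabel {V : Type*} (G : SimpleGraph V) (f : V → ℕ) : V → ℕ :=
  reverseLabel fun u v => G.Adj u v ∧ f u < f v

theorem orientationLabel_injective (G : SimpleGraph V) (f : V → ℕ) :
    Function.Injective (orientationLabel G f) :=
  (reverseLabel_spec f fun _ _ h => h.2).1

theorem orientationLabel_lt (G : SimpleGraph V) (f : V → ℕ) {u v : V} (h : G.Adj u v)
    (huv : f u < f v) : orientationLabel G f v < orientationLabel G f u :=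
  (reverseLabel_spec f fun _ _ h => h.2).2 u v ⟨h, huv⟩

theorem orientationLabel_congr {V : Type*} (G : SimpleGraph V) {f g : V → ℕ}
    (h : ∀ u v, G.Adj u v → (f u < f v ↔ g u < g v)) :
    orientationLabel G f = orientationLabel G g := by
  unfold orientationLabel
  congr 1
  funext u v
  exact propext (and_congr_right fun huv => h u v huv)

theorem coloringKey_injective (G : SimpleGraph V) (κ : V → ℕ) :
    Function.Injective fun v => toLex (κ v, orientationLabel G κ v) := fun _ _ h =>
  orientationLabel_injective G κ (congrArg (fun x => (ofLex x).2) h)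

/-- The order of the vertices by color, and by label among the vertices of the same color. -/
def coloringOrder (G : SimpleGraph V) (κ : V → ℕ) : V ≃ Fin (Fintype.card V) :=
  (exists_equiv_fin_lt_iff (coloringKey_injective G κ)).choose

theorem coloringOrder_lt_iff (G : SimpleGraph V) (κ : V → ℕ) (u v : V) :
    coloringOrder G κ u < coloringOrder G κ v ↔
      κ u < κ v ∨ κ u = κ v ∧ orientationLabel G κ u < orientationLabel G κ v :=
  ((exists_equiv_fin_lt_iff (coloringKey_injective G κ)).choose_spec u v).trans
    Prod.Lex.toLex_lt_toLex

open Classical in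
/-- The set of the (one-based) positions at which the sequence of labels, in the order `w`,
descends. -/
def descentSet (G : SimpleGraph V) (w : V ≃ Fin (Fintype.card V)) : Finset ℕ :=
  (Finset.univ.filter fun k : Fin (Fintype.card V) => ∃ l : Fin (Fintype.card V), (k : ℕ) + 1 = l ∧
    orientationLabel G (fun v => w v) (w.symm l) <
      orientationLabel G (fun v => w v) (w.symm k)).image fun k : Fin (Fintype.card V) => (k : ℕ) + 1

theorem mem_descentSet {G : SimpleGraph V} {w : V ≃ Fin (Fintype.card V)}
    {k l : Fin (Fintype.card V)} (hkl : (k : ℕ) + 1 = l) :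
    (k : ℕ) + 1 ∈ descentSet G w ↔ orientationLabel G (fun v => w v) (w.symm l) <
      orientationLabel G (fun v => w v) (w.symm k) := by
  simp only [descentSet, Finset.mem_image, Finset.mem_filter, Finset.mem_univ, true_and]
  constructor
  · rintro ⟨a, ⟨b, h1, h2⟩, h3⟩
    obtain rfl : a = k := Fin.ext (by omega)
    obtain rfl : b = l := Fin.ext (by omega)
    exact h2
  · exact fun h => ⟨k, ⟨l, hkl, h⟩, rfl⟩

theorem descentSet_subset (G : SimpleGraph V) (w : V ≃ Fin (Fintype.card V)) :
    descentSet G w ⊆ Finset.Icc 1 (Fintype.card V - 1) := by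
  intro k hk
  simp only [descentSet, Finset.mem_image, Finset.mem_filter, Finset.mem_univ, true_and] at hk
  obtain ⟨a, ⟨b, h1, -⟩, rfl⟩ := hk
  have := b.2
  rw [Finset.mem_Icc]
  omega

/-- The index of the fundamental quasi-symmetric function of an order of the vertices. -/
def descentIndex (G : SimpleGraph V) (w : V ≃ Fin (Fintype.card V)) : FundIndex :=
  ⟨Fintype.card V, descentSet G w, Finset.mem_powerset.2 (descentSet_subset G w)⟩

/-- The coloring and the order `w` orient every edge alike, hence have the same labels. Labels
decrease along edges, so the strict increases at descents are what keeps adjacent vertices from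
sharing a color; conversely, inside a color class the order follows the labels, so a descent forces
a change of color. -/
theorem image_comp_eq_properColorings (G : SimpleGraph V) (w : V ≃ Fin (Fintype.card V))
    (e : ℕ →₀ ℕ) :
    (fun i : Fin (Fintype.card V) → ℕ => i ∘ w) '' {i | Monotone i ∧
      (∀ k l : Fin (Fintype.card V), (k : ℕ) + 1 = l → (k : ℕ) + 1 ∈ descentSet G w → i k < i l) ∧
      ∑ k, Finsupp.single (i k) 1 = e} =
    {κ | κ ∈ properColorings G e ∧ coloringOrder G κ = w} := by
  ext κ
  constructor
  · rintro ⟨i, ⟨hm, hd, hc⟩, rfl⟩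
    set ω := orientationLabel G fun v => (w v : ℕ) with hω
    -- At each step either the color grows, or it stays and the label must rise, since a descent
    -- would force the color to grow. So `w` is the order by color and then label.
    have hmono : StrictMono fun k => toLex (i k, ω (w.symm k)) := by
      have hle : ∀ k l : Fin (Fintype.card V), (k : ℕ) + 1 = l →
          toLex (i k, ω (w.symm k)) < toLex (i l, ω (w.symm l)) := by
        intro k l hkl
        rw [Prod.Lex.toLex_lt_toLex]
        have hkl' : k < l := by rw [Fin.lt_def]; omega
        rcases (hm hkl'.le).lt_or_eq with h | h
        · exact Or.inl h
        · refine Or.inr ⟨h, lt_of_le_of_ne (not_lt.1 fun hlt => ?_) fun heq => ?_⟩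
          · exact (hd k l hkl ((mem_descentSet hkl).2 hlt)).ne h
          · exact hkl'.ne (w.symm.injective (orientationLabel_injective G _ heq))
      intro a b hab
      have key : ∀ (n : ℕ) (a b : Fin (Fintype.card V)), (a : ℕ) + n + 1 = b →
          toLex (i a, ω (w.symm a)) < toLex (i b, ω (w.symm b)) := by
        intro n
        induction n with
        | zero => exact fun a b h => hle a b h
        | succ n ih =>
          intro a b h
          have hb := b.2
          exact (ih a ⟨a + n + 1, by omega⟩ rfl).trans (hle _ _ (by simp only; omega))
      rw [Fin.lt_def] at hab
      exact key (b - a - 1) a b (by omega)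
    have hlt : ∀ u v, w u < w v ↔ toLex ((i ∘ w) u, ω u) < toLex ((i ∘ w) v, ω v) := by
      intro u v
      rw [← hmono.lt_iff_lt]
      simp
    -- The label drops along this edge, so the lexicographic increase must come from the color.
    have hadj : ∀ u v, G.Adj u v → w u < w v → (i ∘ w) u < (i ∘ w) v := by
      intro u v huv h
      rcases Prod.Lex.toLex_lt_toLex.1 ((hlt u v).1 h) with h1 | h1
      · exact h1
      · exact absurd h1.2 (not_lt.2 (orientationLabel_lt G _ huv h).le)
    have hcongr : orientationLabel G (i ∘ w) = ω := by
      refine orientationLabel_congr G fun u v huv => ⟨fun h => ?_, fun h => hadj u v huv h⟩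
      by_contra hnot
      have hne : w v ≠ w u := fun h => huv.ne (w.injective h).symm
      exact absurd h (not_lt.2 (hadj v u huv.symm (lt_of_le_of_ne (not_lt.1 hnot) hne)).le)
    refine ⟨⟨fun u v huv => ?_, ?_⟩, ?_⟩
    · rcases lt_or_gt_of_ne (fun h => huv.ne (w.injective h) : w u ≠ w v) with h | h
      · exact (hadj u v huv h).ne
      · exact (hadj v u huv.symm h).ne'
    · rw [← hc]
      exact Equiv.sum_comp w fun k => Finsupp.single (i k) 1
    · refine equiv_fin_unique fun u v => ?_
      rw [coloringOrder_lt_iff, hcongr, hlt, Prod.Lex.toLex_lt_toLex]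
  · rintro ⟨⟨hp, hc⟩, rfl⟩
    set w := coloringOrder G κ with hw
    have hle : ∀ u v, w u ≤ w v → κ u ≤ κ v := by
      intro u v h
      by_contra hnot
      exact absurd h (not_le.2 ((coloringOrder_lt_iff G κ v u).2 (Or.inl (not_le.1 hnot))))
    have hcongr : orientationLabel G (fun v => (w v : ℕ)) = orientationLabel G κ := by
      refine orientationLabel_congr G fun u v huv => ⟨fun h => ?_, fun h => ?_⟩
      · exact lt_of_le_of_ne (hle u v (Fin.le_def.2 h.le)) (hp u v huv)
      · exact (coloringOrder_lt_iff G κ u v).2 (Or.inl h)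
    refine ⟨κ ∘ w.symm, ⟨fun a b hab => hle _ _ (by simpa using hab), fun k l hkl hd => ?_, ?_⟩, ?_⟩
    · rw [mem_descentSet hkl, hcongr] at hd
      have hkl' : w (w.symm k) < w (w.symm l) := by
        simp only [Equiv.apply_symm_apply]
        rw [Fin.lt_def]
        omega
      rcases (coloringOrder_lt_iff G κ _ _).1 hkl' with h | h
      · exact h
      · exact absurd hd (not_lt.2 h.2.le)
    · rw [← hc]
      exact Equiv.sum_comp w.symm fun v => Finsupp.single (κ v) 1
    · funext v
      simp

open Classical in
theorem chromaticSymm_eq_sum (K : Type*) [Field K] (G : SimpleGraph V) :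
    chromaticSymm K G =
      Finsupp.linearCombination K (fundQ K)
        (∑ w : V ≃ Fin (Fintype.card V), Finsupp.single (descentIndex G w) 1) := by
  classical
  rw [map_sum]
  simp only [Finsupp.linearCombination_single, one_smul]
  funext e
  rw [chromaticSymm_apply, MvPowerSeries.sum_apply]
  unfold fundQ
  rw [← Nat.cast_sum]
  congr 1
  rw [Set.ncard_eq_toFinset_card _ (finite_properColorings G e),
    Finset.card_eq_sum_card_fiberwise (f := coloringOrder G) (t := Finset.univ)
      (fun _ _ => Finset.mem_coe.2 (Finset.mem_univ _))]
  refine Finset.sum_congr rfl fun w _ => ?_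
  have h := congrArg Set.ncard (image_comp_eq_properColorings G w e)
  rw [Set.ncard_image_of_injective _ w.surjective.injective_comp_right] at h
  refine Eq.trans ?_ h.symm
  rw [← Set.ncard_coe_finset]
  congr 1
  ext κ
  simp

end descents

/-! ### Transferring `Q`-expansions to `ξ`-expansions. -/

section main

variable {K : Type*} [Field K]

/-- A symmetric function that is a combination of fundamental quasi-symmetric functions is the
combination of the corresponding functions `ξ_λ`. -/
theorem linearCombination_fundQ_eq_linearCombination_xi [CharZero K] (b : FundIndex →₀ K)
    (hb : IsSymmetricFunction (Finsupp.linearCombination K (fundQ K) b)) :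
    Finsupp.linearCombination K (fundQ K) b = Finsupp.linearCombination K (xi K)
      (b.mapDomain fun q => ⟨q.1, subsetType q.1 q.2.1⟩) := by
  rw [← symmetrize_of_isSymmetricFunction hb, Finsupp.linearCombination_mapDomain,
    Finsupp.apply_linearCombination]
  congr 2
  exact funext symmetrize_fundQ_eq_xi

theorem mapDomain_subsetType_apply [DecidableEq (Σ d, Nat.Partition d)] (b : FundIndex →₀ K)
    (d : ℕ) (p : Nat.Partition d) :
    b.mapDomain (fun q => (⟨q.1, subsetType q.1 q.2.1⟩ : Σ d, Nat.Partition d)) ⟨d, p⟩ =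
      ∑ S : ↥(Finset.Icc 1 (d - 1)).powerset with subsetType d S.1 = p, b ⟨d, S⟩ := by
  classical
  induction b using Finsupp.induction_linear with
  | zero => simp
  | add f g hf hg =>
    rw [Finsupp.mapDomain_add, Finsupp.add_apply, hf, hg, ← Finset.sum_add_distrib]
    rfl
  | single q c =>
    rw [Finsupp.mapDomain_single, Finsupp.single_apply]
    obtain ⟨d', S'⟩ := q
    by_cases hd : d' = d
    · subst hd
      by_cases hp : subsetType d' S'.1 = p
      · rw [if_pos (by rw [hp]), Finset.sum_eq_single S']
        · simp
        · intro S _ hS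
          refine Finsupp.single_eq_of_ne fun h => hS ?_
          simpa using h
        · intro h
          rw [Finset.mem_filter, and_iff_right (Finset.mem_univ _)] at h
          exact absurd hp h
      · rw [if_neg fun h => hp (by simpa using h), Finset.sum_eq_zero]
        intro S hS
        refine Finsupp.single_eq_of_ne fun h => hp ?_
        rw [Finset.mem_filter] at hS
        obtain rfl : S = S' := by simpa using h
        exact hS.2
    · rw [if_neg fun h => hd (congrArg Sigma.fst h), Finset.sum_eq_zero]
      intro S _
      exact Finsupp.single_eq_of_ne fun h => hd (congrArg Sigma.fst h).symm

theorem isXiPositive_of_isQPositive [CharZero K] [LinearOrder K] [IsStrictOrderedRing K]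
    {g : MvPowerSeries ℕ K} (hg : IsSymmetricFunction g) (hQ : IsQPositive g) :
    IsXiPositive g := by
  classical
  obtain ⟨b, rfl, hb⟩ := hQ
  refine ⟨_, (linearCombination_fundQ_eq_linearCombination_xi b hg).symm, ?_⟩
  rintro ⟨d, p⟩
  rw [mapDomain_subsetType_apply]
  exact Finset.sum_nonneg fun S _ => hb _

theorem isSymmetricFunction_chromaticSymm {V : Type*} [Fintype V] (G : SimpleGraph V) :
    IsSymmetricFunction (chromaticSymm K G) := by
  refine ⟨fun σ e => ?_, Fintype.card V, fun e he => ?_⟩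
  · change chromaticSymm K G _ = chromaticSymm K G _
    rw [chromaticSymm_apply, chromaticSymm_apply]
    congr 1
    symm
    have hσ : Function.Injective fun κ : V → ℕ => σ ∘ κ := σ.injective.comp_left
    rw [← Set.ncard_image_of_injective _ hσ]
    congr 1
    ext κ
    have hsum : ∀ κ : V → ℕ, ∑ v, Finsupp.single ((σ ∘ κ) v) 1 =
        (∑ v, Finsupp.single (κ v) 1 : ℕ →₀ ℕ).mapDomain σ := by
      intro κ
      rw [Finsupp.mapDomain_finsetSum]
      exact Finset.sum_congr rfl fun v _ => (Finsupp.mapDomain_single (f := σ)).symm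
    constructor
    · rintro ⟨κ, ⟨h1, rfl⟩, rfl⟩
      exact ⟨fun u v huv h => h1 u v huv (σ.injective h), hsum κ⟩
    · rintro ⟨h1, h2⟩
      have hκ : σ ∘ (σ.symm ∘ κ) = κ := by ext v; simp
      refine ⟨σ.symm ∘ κ, ⟨fun u v huv h => h1 u v huv (σ.symm.injective h), ?_⟩, hκ⟩
      apply Finsupp.mapDomain_injective σ.injective
      rw [← hsum, hκ, h2]
  · change chromaticSymm K G e ≠ 0 at he
    rw [chromaticSymm_apply] at he
    have hne : (properColorings G e).Nonempty :=
      Set.nonempty_of_ncard_ne_zero fun h => he (by rw [h, Nat.cast_zero])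
    obtain ⟨κ, -, rfl⟩ := hne
    rw [map_sum]
    simp

theorem isQPositive_chromaticSymm [LinearOrder K] [IsStrictOrderedRing K] {V : Type*} [Fintype V]
    (G : SimpleGraph V) : IsQPositive (chromaticSymm K G) := by
  classical
  refine ⟨_, (chromaticSymm_eq_sum K G).symm, fun q => ?_⟩
  rw [Finsupp.finsetSum_apply]
  refine Finset.sum_nonneg fun w _ => ?_
  rw [Finsupp.single_apply]
  split_ifs
  · exact zero_le_one
  · exact le_rfl

end main

end

theorem theorem4 {K : Type*} [Field K] [CharZero K] :
    (∀ g : MvPowerSeries ℕ K, IsSymmetricFunction g →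
      ∀ (a : (Σ d : ℕ, Nat.Partition d) →₀ K) (b : FundIndex →₀ K),
        g = Finsupp.linearCombination K (xi K) a →
        g = Finsupp.linearCombination K (fundQ K) b →
        ∀ (d : ℕ) (p : Nat.Partition d),
          a ⟨d, p⟩ = ∑ S : ↥(Finset.Icc 1 (d - 1)).powerset with subsetType d S.1 = p, b ⟨d, S⟩) ∧
    (∀ [LinearOrder K] [IsStrictOrderedRing K],
      (∀ g : MvPowerSeries ℕ K, IsSymmetricFunction g → IsQPositive g → IsXiPositive g) ∧
      ∀ {V : Type*} [Fintype V] (G : SimpleGraph V), IsXiPositive (chromaticSymm K G)) := by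
  classical
  refine ⟨fun g hg a b ha hb d p => ?_, fun {_} {_} =>
    ⟨fun g hg hQ => isXiPositive_of_isQPositive hg hQ, fun {V} _ G =>
      isXiPositive_of_isQPositive (isSymmetricFunction_chromaticSymm G)
        (isQPositive_chromaticSymm G)⟩⟩
  -- Symmetrizing the `Q`-expansion gives a second `ξ`-expansion of `g`; independence forces it to
  -- be the given one.
  have h : a = b.mapDomain fun q => ⟨q.1, subsetType q.1 q.2.1⟩ := by
    apply linearIndependent_xi (K := K)
    rw [← ha, hb]
    exact linearCombination_fundQ_eq_linearCombination_xi b (hb ▸ hg)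
  rw [h, mapDomain_subsetType_apply]
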